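/- Let $A$ be a non-trivial finite group, let $k\ge 1$, and let $\omega=\overline{\omega_0\dots\omega_{k-1}}\in\{\mathbf 0,\mathbf 1,\mathbf 2\}^{\mathbb N}$ be a periodic sequence, so $\omega_{n+k}=\omega_n$ for all $n\ge0$. Write $s$ for the shift, $s(\omega)=\omega_1\omega_2\dots$, and regard $\mathbf 0,\mathbf 1,\mathbf 2$ as the three non-trivial homomorphisms from the four-group $\{1,b,c,d\}$ to the group $\{1,a\}$ of order two, vanishing on $b,c,d$ respectively. The Grigorchuk group $G_\omega=\langle a,b,c,d\rangle$ is the group of permutations of $\{1,2\}^\infty$ generated by the map $a=a_\omega$, which exchanges $1$ and $2$ in the first entry, and the maps $x=x_\omega$ for $x\in\{b,c,d\}$, determined by $$x_\omega(1\xi)=1\,\omega_0(x)(\xi),\qquad x_\omega(2\xi)=2\,x_{s(\omega)}(\xi).$$ Let $\rho\in\{1,2\}^\infty$, let $X$ be the $G_\omega$-orbit of $\rho$, and let $W_\omega=A\wr_XG_\omega=\big(\bigoplus_XA\big)\rtimes G_\omega$ be the permutational wreath product. Let $$M_{\mathbf0}=\begin{pmatrix}1&1&1\\0&2&0\\0&0&2\end{pmatrix},\quad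 M_{\mathbf1}=\begin{pmatrix}2&0&0\\1&1&1\\0&0&2\end{pmatrix},\quad M_{\mathbf2}=\begin{pmatrix}2&0&0\\0&2&0\\1&1&1\end{pmatrix},$$ and let $\eta\in(2,3)$ be such that $\eta^k$ is the spectral radius of the product $M_{\omega_{k-1}}\cdots M_{\omega_0}$. Then $W_\omega$ is finitely generated, and its growth satisfies $$v_\omega(R)\sim\exp\big(R^{\log2/\log\eta}\big).$$ Here, for a finite set $S$ generating $W_\omega$ as a semigroup, $v_\omega(R)$ is the number of elements of $W_\omega$ that are products of at most $R$ elements of $S$, and the claim is made for every such $S$. For functions $v,v'\colon\mathbb R_+\to\mathbb R_+$ one writes $v\precsim v'$ if there are constants $C,D>0$ with $v(R)\le v'(CR)$ for all $R>D$, and $v\sim v'$ if $v\precsim v'$ and $v'\precsim v$. -/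

import Mathlib

open scoped SemidirectProduct

namespace GrigorchukWreath

/-! ### Growth functions -/

/-- The growth function of a group with respect to a set `S` generating it as a semigroup:
`growth S R` is the number of elements that are products of at most `R` elements of `S`. -/
noncomputable def growth {G : Type*} [Group G] (S : Set G) (R : ℝ) : ℝ :=
  (Set.ncard {g : G | ∃ l : List G, (∀ s ∈ l, s ∈ S) ∧ (l.length : ℝ) ≤ R ∧ l.prod = g} : ℝ)

/-- The preorder on growth functions: `v R ≤ v' (C * R)` for all large `R`. -/
def GrowthLE (v v' : ℝ → ℝ) : Prop :=
  ∃ C : ℝ, 0 < C ∧ ∃ D : ℝ, 0 < D ∧ ∀ R : ℝ, D < R → v R ≤ v' (C * R)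

/-- Equivalence of growth functions. -/
def GrowthEquiv (v v' : ℝ → ℝ) : Prop :=
  GrowthLE v v' ∧ GrowthLE v' v

/-! ### Permutational (restricted) wreath products -/

/-- The direct sum (restricted direct product) of copies of `A` indexed by `X`: the group of
functions `X → A` that are trivial outside a finite set. -/
def finSuppFun (X A : Type*) [Group A] : Subgroup (X → A) where
  carrier := {f | (Function.mulSupport f).Finite}
  one_mem' := by simp
  mul_mem' := fun {f g} hf hg =>
    (Set.Finite.union hf hg).subset (Function.mulSupport_mul f g)
  inv_mem' := fun {f} hf => by
    have h : Function.mulSupport f⁻¹ = Function.mulSupport f := Function.mulSupport_inv f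
    change (Function.mulSupport f⁻¹).Finite
    rw [h]
    exact hf

section Wreath

variable (A G X : Type*) [Group A] [Group G] [MulAction G X]

theorem finite_mulSupport_smul (g : G) {f : X → A} (hf : (Function.mulSupport f).Finite) :
    (Function.mulSupport fun x => f (g • x)).Finite :=
  Set.Finite.preimage (f := fun x : X => g • x) (MulAction.injective g).injOn hf

/-- The permutation action of `G` on finitely supported functions `X → A`,
`(g f) x = f (g⁻¹ x)`; it carries a function supported at `x` to one supported at `g x`. -/
def permAction : G →* MulAut (finSuppFun X A) where
  toFun g :=
    { toFun := fun f => ⟨fun x => f.1 (g⁻¹ • x), finite_mulSupport_smul A G X g⁻¹ f.2⟩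
      invFun := fun f => ⟨fun x => f.1 (g • x), finite_mulSupport_smul A G X g f.2⟩
      left_inv := fun f => by ext x; simp
      right_inv := fun f => by ext x; simp
      map_mul' := fun _ _ => rfl }
  map_one' := by ext f x; simp
  map_mul' g h := by ext f x; simp [mul_smul]

/-- The permutational wreath product `A ≀_X G`, the semidirect product of the restricted direct
product of copies of `A` indexed by `X` with `G`. -/
abbrev PermWreath : Type _ := finSuppFun X A ⋊[permAction A G X] G

end Wreath

/-! ### The Grigorchuk groups

The alphabet of the binary tree is `{1, 2}`, encoded in `Bool` by `1 = false` and `2 = true`.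
The three nontrivial involutions `b, c, d` of the four-group are indexed by `Fin 3`, and
the letter `i : Fin 3` of `ω` is the nontrivial homomorphism from `{1, b, c, d}` to `{1, a}`
that vanishes on the `i`-th of `b, c, d`. -/

/-- The shift, deleting the first entry of a sequence. -/
def shift {α : Type*} (u : ℕ → α) : ℕ → α := fun n => u (n + 1)

/-- The infinite sequence starting with `x` and continuing with `u`. -/
def cons {α : Type*} (x : α) (u : ℕ → α) : ℕ → α
  | 0 => x
  | n + 1 => u n

/-- The map `a`, exchanging the letters `1` and `2` in the first entry. -/
def rootFun (ξ : ℕ → Bool) : ℕ → Bool := cons (!(ξ 0)) (shift ξ)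

theorem rootFun_rootFun (ξ : ℕ → Bool) : rootFun (rootFun ξ) = ξ := by
  funext n
  cases n <;> simp [rootFun, cons, shift]

/-- The generator `a`. -/
def genA : Equiv.Perm (ℕ → Bool) := ⟨rootFun, rootFun, rootFun_rootFun, rootFun_rootFun⟩

/-- The image of the `x`-th of `b, c, d` under the homomorphism `i`: trivial for `x = i`, and
`a` otherwise. -/
def letterHom (i x : Fin 3) : Equiv.Perm (ℕ → Bool) := if x = i then 1 else genA

/-- The map given by the `x`-th of `b, c, d`: the decomposition `⟨ω₀(x), x⟩`, meaning that it acts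
as `ω₀(x)` on the sequence following an initial letter `1`, and as the `x`-th generator
of the shifted sequence `ω₁ω₂…` after an initial letter `2`. -/
def spinalFun (x : Fin 3) : (ω : ℕ → Fin 3) → (ξ : ℕ → Bool) → ℕ → Bool
  | _, ξ, 0 => ξ 0
  | ω, ξ, n + 1 =>
    if ξ 0 = true then spinalFun x (shift ω) (shift ξ) n
    else letterHom (ω 0) x (shift ξ) n

theorem letterHom_letterHom (i x : Fin 3) (ξ : ℕ → Bool) :
    letterHom i x (letterHom i x ξ) = ξ := by
  unfold letterHom
  split_ifs
  · rfl
  · exact rootFun_rootFun ξ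

/-- `x (1 ξ) = 1 ω₀(x)(ξ)`. -/
theorem spinalFun_cons_false (x : Fin 3) (ω : ℕ → Fin 3) (ξ : ℕ → Bool) :
    spinalFun x ω (cons false ξ) = cons false (letterHom (ω 0) x ξ) := by
  funext n
  cases n with
  | zero => simp [spinalFun, cons]
  | succ n =>
    have h : shift (cons false ξ) = ξ := rfl
    simp [spinalFun, cons, h]

/-- `x (2 ξ) = 2 x(ξ)`, where the last `x` is that of the shifted sequence. -/
theorem spinalFun_cons_true (x : Fin 3) (ω : ℕ → Fin 3) (ξ : ℕ → Bool) :
    spinalFun x ω (cons true ξ) = cons true (spinalFun x (shift ω) ξ) := by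
  funext n
  cases n with
  | zero => simp [spinalFun, cons]
  | succ n =>
    have h : shift (cons true ξ) = ξ := rfl
    simp [spinalFun, cons, h]

theorem cons_shift (ξ : ℕ → Bool) : cons (ξ 0) (shift ξ) = ξ := by
  funext n
  cases n <;> rfl

theorem spinalFun_spinalFun (x : Fin 3) (ω : ℕ → Fin 3) (ξ : ℕ → Bool) :
    spinalFun x ω (spinalFun x ω ξ) = ξ := by
  funext n
  induction n generalizing ω ξ with
  | zero => simp [spinalFun]
  | succ n ih =>
    rw [← cons_shift ξ]
    cases ξ 0 with
    | false => rw [spinalFun_cons_false, spinalFun_cons_false, letterHom_letterHom]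
    | true =>
      rw [spinalFun_cons_true, spinalFun_cons_true]
      exact ih (shift ω) (shift ξ)

/-- The generators `b, c, d` (for `x = 0, 1, 2`). -/
def genBCD (ω : ℕ → Fin 3) (x : Fin 3) : Equiv.Perm (ℕ → Bool) :=
  ⟨spinalFun x ω, spinalFun x ω, spinalFun_spinalFun x ω, spinalFun_spinalFun x ω⟩

/-- The Grigorchuk group `G_ω = ⟨a, b, c, d⟩`, as a group of permutations of the set of
infinite sequences over `{1, 2}`. -/
def grigorchukGroup (ω : ℕ → Fin 3) : Subgroup (Equiv.Perm (ℕ → Bool)) :=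
  Subgroup.closure ({genA} ∪ Set.range (genBCD ω))

/-- The orbit `X` of `ρ` under `G_ω`. -/
abbrev orbitX (ω : ℕ → Fin 3) (ρ : ℕ → Bool) : Set (ℕ → Bool) :=
  MulAction.orbit (grigorchukGroup ω) ρ

/-- The group `W_ω = A ≀_X G_ω`, where `X` is the orbit of `ρ`. -/
abbrev WGroup (A : Type*) [Group A] (ω : ℕ → Fin 3) (ρ : ℕ → Bool) : Type _ :=
  PermWreath A (grigorchukGroup ω) (orbitX ω ρ)

/-! ### The matrices -/

/-- The matrices `M_0, M_1, M_2`. -/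
def matM : Fin 3 → Matrix (Fin 3) (Fin 3) ℂ :=
  ![!![1, 1, 1; 0, 2, 0; 0, 0, 2],
    !![2, 0, 0; 1, 1, 1; 0, 0, 2],
    !![2, 0, 0; 0, 2, 0; 1, 1, 1]]

/-- The product `M_{ω_{k-1}} ⋯ M_{ω_0}`. -/
def matProd (ω : ℕ → Fin 3) : ℕ → Matrix (Fin 3) (Fin 3) ℂ
  | 0 => 1
  | k + 1 => matM (ω k) * matProd ω k

end GrigorchukWreath

/-! Both bounds rest on one family of weights. If some letter did not occur in `ω`, the spectral
radius would be less than `η ^ k`; hence the product over a period maps nonzero nonnegative vectors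
to positive ones. Its Perron vector, carried along `ω` and divided by powers of `η`, gives periodic
positive weights `V n` with `η V (n + 1) = M_{ω n} V n` (`exists_weights`). The number `V n x` is
the weight of the two-letter word `ax` at level `n`.

Upper bound. The weights split as `V n x = α n + ν n x`, where `ν n` is a norm on the four-group
(`exists_contractingNorm`). The triangle inequality for `ν n` needs a positive defect of the weights
(`defect_pos`), which again follows from periodicity. Under the wreath recursion the total norm of
the two components is at most `2 / η` times the original norm, up to a bounded error
(`Represents.exists_node`). Lamps cost nothing: they sit at one of a bounded number of points near
`ρ`, and this shape is preserved by the recursion. After `n` levels an element of norm `t` is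
described by `2 ^ n` lists and `n` levels of signs, of total length `O((2 / η) ^ n * t + 2 ^ n)`; a
generating function shows that there are at most exponentially many such codes
(`card_le_of_code_size_le`). For `η ^ n` close to `R` both terms are of order `2 ^ n`, which is
comparable to `R ^ (log 2 / log η)`.

Lower bound. A substitution on words in the elements `ax`, with matrix `M_i`, multiplies the weight
by `η` when passing up one level and at least doubles the set of points visited by `ρ` and `a ρ`
under prefixes (`two_mul_ncard_trace_le`). So words of length `O(η ^ n)` visit at least `2 ^ n`
points (`exists_word`). Lamps can be inserted along such a word independently at all these points,
which gives at least `2 ^ (2 ^ n)` elements of length `O(η ^ n)` (`le_growth`). -/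

namespace GrigorchukWreath

/-! ### The action of the matrices on vectors -/

/-- The action of the matrix `M_i` on column vectors. -/
def stepVec {R : Type*} [Semiring R] (i : Fin 3) (v : Fin 3 → R) : Fin 3 → R :=
  fun x => if x = i then v 0 + v 1 + v 2 else 2 * v x

/-- The action of `M_{ω_{n-1}} ⋯ M_{ω_0}` on column vectors. -/
def iterVec {R : Type*} [Semiring R] (ω : ℕ → Fin 3) : ℕ → (Fin 3 → R) → Fin 3 → R
  | 0, v => v
  | n + 1, v => stepVec (ω n) (iterVec ω n v)

theorem matM_mulVec (i : Fin 3) (v : Fin 3 → ℂ) : (matM i).mulVec v = stepVec i v := by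
  funext x
  fin_cases i <;> fin_cases x <;>
    simp [matM, stepVec, Matrix.mulVec, dotProduct, Fin.sum_univ_three]

theorem matProd_mulVec (ω : ℕ → Fin 3) (n : ℕ) (v : Fin 3 → ℂ) :
    (matProd ω n).mulVec v = iterVec ω n v := by
  induction n with
  | zero => simp [matProd, iterVec]
  | succ n ih => rw [matProd, ← Matrix.mulVec_mulVec, ih, matM_mulVec]; rfl

theorem stepVec_mono (i : Fin 3) {v w : Fin 3 → ℝ} (h : v ≤ w) : stepVec i v ≤ stepVec i w := by
  intro x
  have h0 := h 0; have h1 := h 1; have h2 := h 2; have hx := h x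
  unfold stepVec
  split_ifs <;> linarith

theorem iterVec_mono (ω : ℕ → Fin 3) (n : ℕ) {v w : Fin 3 → ℝ} (h : v ≤ w) :
    iterVec ω n v ≤ iterVec ω n w := by
  induction n with
  | zero => exact h
  | succ n ih => exact stepVec_mono _ ih

theorem norm_iterVec_le (ω : ℕ → Fin 3) (n : ℕ) (v : Fin 3 → ℂ) :
    (fun x => ‖iterVec ω n v x‖) ≤ iterVec ω n fun x => ‖v x‖ := by
  induction n with
  | zero => exact le_rfl
  | succ n ih =>
    refine le_trans (fun x => ?_) (stepVec_mono (ω n) ih)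
    simp only [iterVec, stepVec]
    split_ifs
    · exact norm_add₃_le
    · simp

theorem iterVec_smul (ω : ℕ → Fin 3) (n : ℕ) (c : ℝ) (v : Fin 3 → ℝ) :
    iterVec ω n (c • v) = c • iterVec ω n v := by
  induction n with
  | zero => rfl
  | succ n ih =>
    funext x
    simp only [iterVec, ih, stepVec, Pi.smul_apply, smul_eq_mul]
    split_ifs <;> ring

theorem iterVec_sub (ω : ℕ → Fin 3) (n : ℕ) (v w : Fin 3 → ℝ) :
    iterVec ω n (v - w) = iterVec ω n v - iterVec ω n w := by
  induction n with
  | zero => rfl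
  | succ n ih =>
    funext x
    simp only [iterVec, ih, stepVec, Pi.sub_apply]
    split_ifs <;> ring

theorem iterVec_ofReal (ω : ℕ → Fin 3) (n : ℕ) (v : Fin 3 → ℝ) :
    iterVec ω n (fun x => (v x : ℂ)) = fun x => ((iterVec ω n v x : ℝ) : ℂ) := by
  induction n with
  | zero => rfl
  | succ n ih =>
    funext x
    simp only [iterVec, ih, stepVec]
    split_ifs <;> push_cast <;> rfl

theorem continuous_iterVec (ω : ℕ → Fin 3) (n : ℕ) :
    Continuous (iterVec ω n : (Fin 3 → ℝ) → Fin 3 → ℝ) := by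
  induction n with
  | zero => exact continuous_id
  | succ n ih =>
    have h : ∀ y, Continuous fun v : Fin 3 → ℝ => iterVec ω n v y :=
      fun y => (continuous_apply y).comp ih
    refine continuous_pi fun x => ?_
    simp only [iterVec, stepVec]
    split_ifs
    · exact ((h 0).add (h 1)).add (h 2)
    · exact continuous_const.mul (h x)

theorem iterVec_nonneg (ω : ℕ → Fin 3) (n : ℕ) {v : Fin 3 → ℝ} (h : 0 ≤ v) :
    0 ≤ iterVec ω n v := by
  have h0 : iterVec ω n (0 : Fin 3 → ℝ) = 0 := by simpa using iterVec_smul ω n 0 (0 : Fin 3 → ℝ)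
  simpa [h0] using iterVec_mono ω n h

theorem iterVec_le_succ (ω : ℕ → Fin 3) (n : ℕ) {v : Fin 3 → ℝ} (h : 0 ≤ v) :
    iterVec ω n v ≤ iterVec ω (n + 1) v := by
  intro x
  have hn := iterVec_nonneg ω n h
  have h0 := hn 0; have h1 := hn 1; have h2 := hn 2
  simp only [Pi.zero_apply] at h0 h1 h2
  simp only [iterVec, stepVec]
  split_ifs <;> fin_cases x <;> simp <;> linarith

/-- Coordinates never decrease, and reading the letter `x` replaces the coordinate `x` by the sum of
all three. -/
theorem iterVec_pos (ω : ℕ → Fin 3) (k : ℕ) (hall : ∀ x, ∃ m < k, ω m = x)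
    {v : Fin 3 → ℝ} (h : 0 ≤ v) (hne : v ≠ 0) (x : Fin 3) : 0 < iterVec ω k v x := by
  have hmono : Monotone fun n => iterVec ω n v :=
    monotone_nat_of_le_succ fun n => iterVec_le_succ ω n h
  obtain ⟨m, hm, rfl⟩ := hall x
  refine lt_of_lt_of_le ?_ (hmono (Nat.succ_le_of_lt hm) (ω m))
  have hge : v ≤ iterVec ω m v := hmono (Nat.zero_le m)
  obtain ⟨y, hy⟩ := Function.ne_iff.mp hne
  have hy' : 0 < v y := lt_of_le_of_ne (h y) (Ne.symm hy)
  have e0 := hge 0; have e1 := hge 1; have e2 := hge 2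
  have h0 := h 0; have h1 := h 1; have h2 := h 2
  simp only [Pi.zero_apply] at h0 h1 h2
  simp only [iterVec, stepVec, if_true]
  fin_cases y <;> simp at hy' <;> linarith

/-- The columns of each matrix sum to 1 or 3. The bound confines the candidates for the Perron
eigenvalue to a compact interval. -/
theorem iterVec_sum_le (ω : ℕ → Fin 3) (n : ℕ) {v : Fin 3 → ℝ} (h : 0 ≤ v) :
    iterVec ω n v 0 + iterVec ω n v 1 + iterVec ω n v 2 ≤ 3 ^ n * (v 0 + v 1 + v 2) := by
  induction n with
  | zero => simp [iterVec]
  | succ n ih =>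
    have hn := iterVec_nonneg ω n h
    have h0 := hn 0; have h1 := hn 1; have h2 := hn 2
    simp only [Pi.zero_apply] at h0 h1 h2
    simp only [iterVec, stepVec, pow_succ]
    generalize ω n = i
    fin_cases i <;> simp <;> linarith

/-! ### The spectral radius -/

/-- A positive vector `V` with `P V ≤ r V` bounds the spectral radius of the nonnegative
matrix `P` by `r`. -/
theorem spectralRadius_matProd_le (ω : ℕ → Fin 3) (k : ℕ) {V : Fin 3 → ℝ} (hV : ∀ x, 0 < V x)
    {r : ℝ} (h : iterVec ω k V ≤ r • V) :
    spectralRadius ℂ (matProd ω k) ≤ ENNReal.ofReal r := by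
  refine iSup₂_le fun μ hμ => ?_
  have hμ' : Module.End.HasEigenvalue (Matrix.toLin' (matProd ω k)) μ := by
    rw [Module.End.hasEigenvalue_iff_mem_spectrum, Matrix.spectrum_toLin']
    exact hμ
  obtain ⟨u, hu⟩ := hμ'.exists_hasEigenvector
  have hne : u ≠ 0 := hu.2
  have hueq : iterVec ω k u = μ • u := by
    have := hu.apply_eq_smul
    rwa [Matrix.toLin'_apply, matProd_mulVec] at this
  -- The eigenvector `u` is compared with the least multiple of `V` that dominates it; equality
  -- holds at `i`.
  obtain ⟨i, -, hi⟩ := Finset.exists_max_image Finset.univ (fun x => ‖u x‖ / V x)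
    Finset.univ_nonempty
  set c := ‖u i‖ / V i with hc
  have hle : (fun x => ‖u x‖) ≤ c • V := fun x => by
    have := hi x (Finset.mem_univ x)
    rw [div_le_iff₀ (hV x)] at this
    simpa using this
  have hc0 : 0 ≤ c := div_nonneg (norm_nonneg _) (hV i).le
  have hui : ‖u i‖ = c * V i := by rw [hc, div_mul_cancel₀ _ (hV i).ne']
  have hcpos : 0 < c := by
    refine lt_of_le_of_ne hc0 fun hz => hne ?_
    funext x
    have := hle x
    simp only [← hz, zero_smul, Pi.zero_apply] at this
    simpa using this
  have h1 : ‖μ‖ * (c * V i) ≤ c * (r * V i) := by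
    calc ‖μ‖ * (c * V i) = ‖iterVec ω k u i‖ := by rw [hueq, ← hui]; simp
      _ ≤ iterVec ω k (fun x => ‖u x‖) i := norm_iterVec_le ω k u i
      _ ≤ iterVec ω k (c • V) i := iterVec_mono ω k hle i
      _ = c * iterVec ω k V i := by rw [iterVec_smul]; rfl
      _ ≤ c * (r * V i) := mul_le_mul_of_nonneg_left (h i) hc0
  have h2 : ‖μ‖ ≤ r := by
    have hp : 0 < c * V i := mul_pos hcpos (hV i)
    have : ‖μ‖ * (c * V i) ≤ r * (c * V i) := by linarith
    exact le_of_mul_le_mul_right this hp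
  rw [← ENNReal.ofReal_coe_nnreal]
  exact ENNReal.ofReal_le_ofReal h2

theorem le_spectralRadius_matProd (ω : ℕ → Fin 3) (k : ℕ) {V : Fin 3 → ℝ} (hV : V ≠ 0)
    {r : ℝ} (hr : 0 ≤ r) (h : iterVec ω k V = r • V) :
    ENNReal.ofReal r ≤ spectralRadius ℂ (matProd ω k) := by
  have hmem : (r : ℂ) ∈ spectrum ℂ (matProd ω k) := by
    rw [← Matrix.spectrum_toLin', ← Module.End.hasEigenvalue_iff_mem_spectrum]
    refine Module.End.hasEigenvalue_of_hasEigenvector (x := fun x => (V x : ℂ)) ⟨?_, ?_⟩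
    · rw [Module.End.mem_eigenspace_iff, Matrix.toLin'_apply, matProd_mulVec, iterVec_ofReal, h]
      funext x
      simp
    · intro h0
      apply hV
      funext x
      simpa using congrFun h0 x
  refine le_trans ?_ (le_iSup₂ (f := fun μ (_ : μ ∈ spectrum ℂ (matProd ω k)) => (‖μ‖₊ : ENNReal))
    (r : ℂ) hmem)
  rw [← ENNReal.ofReal_coe_nnreal]
  refine ENNReal.ofReal_le_ofReal ?_
  simp [abs_of_nonneg hr]

/-- If a letter does not occur in `ω`, the growth rate is at most `2`. -/
theorem exists_eq_of_two_lt (ω : ℕ → Fin 3) (k : ℕ) {η : ℝ} (hη₂ : 2 < η) (hk : 0 < k)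
    (hη : spectralRadius ℂ (matProd ω k) = ENNReal.ofReal (η ^ k)) (x : Fin 3) :
    ∃ m < k, ω m = x := by
  by_contra! hx
  set ε := (η - 2) / 2 with hε
  have hε0 : 0 < ε := by rw [hε]; linarith
  -- As the letter `x` is never read, its weight may be small: every other letter then sums the
  -- weights to `2 + ε`, which lies below `η`.
  set V : Fin 3 → ℝ := fun y => if y = x then ε else 1 with hV
  have hVpos : ∀ y, 0 < V y := fun y => by
    simp only [hV]; split_ifs
    · exact hε0
    · exact one_pos
  have hstep : ∀ i, i ≠ x → stepVec i V ≤ (2 + ε) • V := by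
    intro i hi y
    simp only [stepVec, hV, Pi.smul_apply, smul_eq_mul]
    fin_cases x <;> fin_cases i <;> fin_cases y <;> simp at hi ⊢ <;> nlinarith
  have hiter : ∀ n ≤ k, iterVec ω n V ≤ (2 + ε) ^ n • V := by
    intro n
    induction n with
    | zero => intro _; simp [iterVec]
    | succ n ih =>
      intro hn
      have h1 := stepVec_mono (ω n) (ih (by omega))
      have h2 : stepVec (ω n) ((2 + ε) ^ n • V) = (2 + ε) ^ n • stepVec (ω n) V :=
        iterVec_smul (fun _ => ω n) 1 _ V
      refine h1.trans ?_
      rw [h2, pow_succ, mul_smul]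
      exact smul_le_smul_of_nonneg_left (hstep _ (hx n (by omega))) (by positivity)
  have h := spectralRadius_matProd_le ω k hVpos (hiter k le_rfl)
  rw [hη, ENNReal.ofReal_le_ofReal_iff (by positivity)] at h
  have : (2 + ε) ^ k < η ^ k := pow_lt_pow_left₀ (by rw [hε]; linarith) (by positivity) hk.ne'
  linarith

/-- The Perron eigenvector. -/
theorem exists_pos_eigenvector (ω : ℕ → Fin 3) (k : ℕ) (hall : ∀ x, ∃ m < k, ω m = x) :
    ∃ (V : Fin 3 → ℝ) (r : ℝ), (∀ x, 0 < V x) ∧ 0 < r ∧ iterVec ω k V = r • V := by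
  have hsum : ∀ v ∈ stdSimplex ℝ (Fin 3), v 0 + v 1 + v 2 = 1 := fun v hv => by
    rw [← Fin.sum_univ_three]; exact hv.2
  -- Collatz–Wielandt: `r` is taken maximal among the numbers with `r V ≤ P V` for some `V` in the
  -- simplex, where `P` is the product over a period.
  set K : Set (ℝ × (Fin 3 → ℝ)) :=
    (Set.Icc 0 (3 ^ k) ×ˢ stdSimplex ℝ (Fin 3)) ∩ {p | p.1 • p.2 ≤ iterVec ω k p.2} with hK
  have hKc : IsCompact K := by
    refine (isCompact_Icc.prod (isCompact_stdSimplex ℝ (Fin 3))).inter_right ?_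
    exact isClosed_le (continuous_fst.smul continuous_snd)
      ((continuous_iterVec ω k).comp continuous_snd)
  have hKne : K.Nonempty := by
    refine ⟨(0, Pi.single 0 1), ⟨⟨le_rfl, by positivity⟩, single_mem_stdSimplex ℝ 0⟩, ?_⟩
    simp only [Set.mem_ofPred_eq, zero_smul]
    exact iterVec_nonneg ω k (single_mem_stdSimplex ℝ (0 : Fin 3)).1
  obtain ⟨⟨r, V⟩, ⟨⟨⟨hr0, -⟩, hVs⟩, hle⟩, hmax⟩ :=
    hKc.exists_isMaxOn hKne continuous_fst.continuousOn
  simp only [Set.mem_ofPred_eq] at hr0 hVs hle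
  have hV0 : V ≠ 0 := fun h => by have := hsum V hVs; simp [h] at this
  have hP : ∀ x, 0 < iterVec ω k V x := iterVec_pos ω k hall hVs.1 hV0
  have heq : iterVec ω k V = r • V := by
    by_contra hne
    -- If `P V ≠ r V`, applying `P` to the nonzero nonnegative difference makes every inequality
    -- strict, so `P V`, normalised, admits a larger `r`.
    set w := iterVec ω k V with hw
    have hwnn : 0 ≤ w := fun x => (hP x).le
    have hu : ∀ x, 0 < iterVec ω k (w - r • V) x :=
      iterVec_pos ω k hall (sub_nonneg.mpr hle) (sub_ne_zero.mpr hne)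
    have hlt : ∀ x, r * w x < iterVec ω k w x := fun x => by
      have := hu x
      rw [iterVec_sub, iterVec_smul, ← hw] at this
      simpa using this
    obtain ⟨i, -, hi⟩ := Finset.exists_min_image Finset.univ (fun x => iterVec ω k w x / w x)
      Finset.univ_nonempty
    set r' := iterVec ω k w i / w i with hr'
    have hrr' : r < r' := by rw [hr', lt_div_iff₀ (hP i)]; exact hlt i
    have hr'le : r' • w ≤ iterVec ω k w := fun x => by
      have := hi x (Finset.mem_univ x)
      rwa [le_div_iff₀ (hP x)] at this
    set s := w 0 + w 1 + w 2 with hs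
    have hspos : 0 < s := by have := hP 0; have := hP 1; have := hP 2; linarith
    have hmem : (r', s⁻¹ • w) ∈ K := by
      have hle' : r' • (s⁻¹ • w) ≤ iterVec ω k (s⁻¹ • w) := by
        rw [iterVec_smul, smul_comm]
        exact smul_le_smul_of_nonneg_left hr'le (by positivity)
      have hnn : 0 ≤ s⁻¹ • w := smul_nonneg (by positivity) hwnn
      have hs1 : (s⁻¹ • w) 0 + (s⁻¹ • w) 1 + (s⁻¹ • w) 2 = 1 := by
        simp only [Pi.smul_apply, smul_eq_mul]
        rw [← mul_add, ← mul_add, ← hs, inv_mul_cancel₀ hspos.ne']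
      refine ⟨⟨⟨by linarith, ?_⟩, ⟨hnn, by rw [Fin.sum_univ_three]; exact hs1⟩⟩, hle'⟩
      have hb := iterVec_sum_le ω k hnn
      rw [hs1, mul_one] at hb
      have e0 := hle' 0; have e1 := hle' 1; have e2 := hle' 2
      simp only [Pi.smul_apply, smul_eq_mul] at e0 e1 e2 hs1 hb
      nlinarith
    have := hmax hmem
    simp only [Set.mem_ofPred_eq] at this
    linarith
  have hrV : ∀ x, 0 < r * V x := fun x => by
    have := hP x; rw [heq] at this; simpa using this
  have hrpos : 0 < r := lt_of_le_of_ne hr0 fun h => by have := hrV 0; simp [← h] at this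
  exact ⟨V, r, fun x => (mul_pos_iff_of_pos_left hrpos).1 (hrV x), hrpos, heq⟩

/-! ### Periodic weights -/

theorem iterVec_add_period (ω : ℕ → Fin 3) (k : ℕ) (hω : ∀ n, ω (n + k) = ω n) (n : ℕ)
    (v : Fin 3 → ℝ) : iterVec ω (n + k) v = iterVec ω n (iterVec ω k v) := by
  induction n with
  | zero => simp [iterVec]
  | succ n ih =>
    rw [show n + 1 + k = (n + k) + 1 by ring, iterVec, ih, hω]; rfl

/-- The Perron eigenvalue over one period is `η ^ k`, so dividing the orbit of the Perron vector by
`η ^ n` makes it periodic. -/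
theorem exists_weights (ω : ℕ → Fin 3) (k : ℕ) (hk : 0 < k) (hω : ∀ n, ω (n + k) = ω n)
    (η : ℝ) (hη₂ : 2 < η) (hη : spectralRadius ℂ (matProd ω k) = ENNReal.ofReal (η ^ k)) :
    ∃ V : ℕ → Fin 3 → ℝ, (∀ n x, 0 < V n x) ∧ (∀ n, V (n + k) = V n) ∧
      ∀ n, η • V (n + 1) = stepVec (ω n) (V n) := by
  obtain ⟨V, r, hV, hr, h⟩ := exists_pos_eigenvector ω k (exists_eq_of_two_lt ω k hη₂ hk hη)
  have hη0 : 0 < η := by linarith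
  have hrη : r = η ^ k := by
    have h1 := spectralRadius_matProd_le ω k hV h.le
    have h2 := le_spectralRadius_matProd ω k (V := V)
      (fun h0 => (hV 0).ne' (congrFun h0 0)) hr.le h
    rw [hη, ENNReal.ofReal_le_ofReal_iff hr.le] at h1
    rw [hη, ENNReal.ofReal_le_ofReal_iff (by positivity)] at h2
    exact le_antisymm h2 h1
  refine ⟨fun n => (η ^ n)⁻¹ • iterVec ω n V, fun n x => ?_, fun n => ?_, fun n => ?_⟩
  · have hmono : Monotone fun n => iterVec ω n V :=
      monotone_nat_of_le_succ fun n => iterVec_le_succ ω n fun x => (hV x).le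
    have h1 : V x ≤ iterVec ω n V x := hmono (Nat.zero_le n) x
    have h2 := hV x
    simp only [Pi.smul_apply, smul_eq_mul]
    exact mul_pos (by positivity) (by linarith)
  · simp only
    rw [iterVec_add_period ω k hω, h, iterVec_smul, hrη, smul_smul, pow_add]
    congr 1
    field_simp
  · have h2 : stepVec (ω n) ((η ^ n)⁻¹ • iterVec ω n V) =
        (η ^ n)⁻¹ • stepVec (ω n) (iterVec ω n V) := iterVec_smul (fun _ => ω n) 1 _ _
    simp only
    rw [h2, smul_smul]
    simp only [iterVec]
    congr 1
    rw [pow_succ]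
    field_simp

theorem exists_bounds_of_periodic {f : ℕ → ℝ} {k : ℕ} (hk : 0 < k) (hf : ∀ n, f (n + k) = f n)
    (hpos : ∀ n, 0 < f n) : ∃ c C : ℝ, 0 < c ∧ ∀ n, c ≤ f n ∧ f n ≤ C := by
  have hne : (Finset.range k).Nonempty := ⟨0, by simpa using hk⟩
  obtain ⟨i, -, hi⟩ := Finset.exists_min_image (Finset.range k) f hne
  obtain ⟨j, -, hj⟩ := Finset.exists_max_image (Finset.range k) f hne
  refine ⟨f i, f j, hpos i, fun n => ?_⟩
  have hp : Function.Periodic f k := hf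
  rw [← hp.map_mod_nat n]
  have hm : n % k ∈ Finset.range k := Finset.mem_range.mpr (Nat.mod_lt _ hk)
  exact ⟨hi _ hm, hj _ hm⟩

/-- The defect in the triangle inequality. -/
def defect (v : Fin 3 → ℝ) (x : Fin 3) : ℝ := v 0 + v 1 + v 2 - 2 * v x

theorem defect_stepVec_self (i : Fin 3) (v : Fin 3 → ℝ) :
    defect (stepVec i v) i = defect v i := by
  fin_cases i <;> simp [defect, stepVec] <;> ring

theorem defect_stepVec_of_ne {i x : Fin 3} (h : x ≠ i) {v : Fin 3 → ℝ} (hv : ∀ x, 0 < v x) :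
    defect v x < defect (stepVec i v) x := by
  have h0 := hv 0; have h1 := hv 1; have h2 := hv 2
  fin_cases i <;> fin_cases x <;> simp [defect, stepVec] at h ⊢ <;> linarith

/-- The difference is `2 * v i` for `x = i`, and otherwise the defect of `v` at the third letter. -/
theorem stepVec_sub_defect_nonneg (i : Fin 3) {v : Fin 3 → ℝ} (hv : ∀ x, 0 < v x)
    (hd : ∀ x, 0 < defect v x) (x : Fin 3) : 0 ≤ stepVec i v x - defect v i := by
  have h0 := hv 0; have h1 := hv 1; have h2 := hv 2
  have d0 := hd 0; have d1 := hd 1; have d2 := hd 2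
  simp only [defect] at d0 d1 d2
  fin_cases i <;> fin_cases x <;> simp [defect, stepVec] <;> linarith

/-- Equivalently, `defect v i` is at most the defect of `stepVec i v` at `x`, with equality for `x =
i`. This is the triangle inequality that remains after `defect v i` is subtracted from all three
weights. -/
theorem stepVec_sub_defect_triangle (i : Fin 3) {v : Fin 3 → ℝ} (hd : ∀ x, 0 < defect v x)
    {x y z : Fin 3} (hxy : x ≠ y) (hyz : y ≠ z) (hxz : x ≠ z) :
    stepVec i v x + defect v i ≤ stepVec i v y + stepVec i v z := by
  have hsum : ∀ f : Fin 3 → ℝ, f x + f y + f z = f 0 + f 1 + f 2 := fun f => by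
    fin_cases x <;> fin_cases y <;> fin_cases z <;> simp at hxy hyz hxz ⊢ <;> ring
  have h := hsum (stepVec i v)
  have d0 := hd 0; have d1 := hd 1; have d2 := hd 2
  have : 2 * stepVec i v x + defect v i ≤
      stepVec i v 0 + stepVec i v 1 + stepVec i v 2 := by
    clear h hsum hxy hxz
    simp only [defect] at *
    fin_cases i <;> fin_cases x <;> simp [stepVec] <;> linarith
  linarith

/-- A step of the recursion, before division by `η`, preserves the defect at `ω n` and strictly
increases the others. Over a period this reads `d ≤ η ^ k * d`, so `d ≥ 0`; a level whose letter is
not `x` makes it positive, and periodicity spreads this to all levels. -/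
theorem defect_pos {ω : ℕ → Fin 3} {k : ℕ} (hk : 0 < k)
    (hall : ∀ x, ∃ m < k, ω m = x) (hω : ∀ n, ω (n + k) = ω n) {η : ℝ} (hη₂ : 2 < η)
    {V : ℕ → Fin 3 → ℝ} (hV : ∀ n x, 0 < V n x) (hper : ∀ n, V (n + k) = V n)
    (hstep : ∀ n, η • V (n + 1) = stepVec (ω n) (V n)) (n : ℕ) (x : Fin 3) :
    0 < defect (V n) x := by
  have hη0 : 0 < η := by linarith
  have hrec : ∀ n x, η * defect (V (n + 1)) x = defect (stepVec (ω n) (V n)) x := fun n x => by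
    rw [← hstep]
    simp only [defect, Pi.smul_apply, smul_eq_mul]
    ring
  have hge : ∀ n x, defect (V n) x ≤ η * defect (V (n + 1)) x := fun n x => by
    rw [hrec]
    by_cases hx : x = ω n
    · rw [hx, defect_stepVec_self]
    · exact (defect_stepVec_of_ne hx (hV n)).le
  have hpow : ∀ j n x, defect (V n) x ≤ η ^ j * defect (V (n + j)) x := by
    intro j
    induction j with
    | zero => intro n x; simp
    | succ j ih =>
      intro n x
      calc defect (V n) x ≤ η ^ j * defect (V (n + j)) x := ih n x
        _ ≤ η ^ j * (η * defect (V (n + j + 1)) x) :=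
          mul_le_mul_of_nonneg_left (hge _ _) (by positivity)
        _ = _ := by rw [pow_succ]; ring_nf
  have hperj : ∀ j n, V (n + j * k) = V n := by
    intro j
    induction j with
    | zero => simp
    | succ j ih => intro n; rw [Nat.succ_mul, ← add_assoc, hper, ih]
  have hωj : ∀ j n, ω (n + j * k) = ω n := by
    intro j
    induction j with
    | zero => simp
    | succ j ih => intro n; rw [Nat.succ_mul, ← add_assoc, hω, ih]
  have hnn : ∀ n x, 0 ≤ defect (V n) x := by
    intro n x
    have h := hpow k n x
    rw [hper] at h
    have hη1 : 1 < η ^ k := one_lt_pow₀ (by linarith) hk.ne'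
    by_contra! hneg
    nlinarith
  obtain ⟨m, -, hm⟩ := hall (x + 1)
  have hmx : x ≠ ω m := by rw [hm]; simp
  have hmpos : 0 < defect (V (m + 1)) x := by
    have h1 := hnn m x
    have h2 := defect_stepVec_of_ne hmx (hV m)
    exact (mul_pos_iff_of_pos_left hη0).1 (by rw [hrec]; linarith)
  have hle : m + 1 ≤ n + (m + 1) * k := by nlinarith
  obtain ⟨j, hj⟩ := Nat.exists_eq_add_of_le hle
  have h := hpow j (m + 1) x
  rw [← hj, hperj] at h
  exact (mul_pos_iff_of_pos_left (by positivity)).1 (lt_of_lt_of_le hmpos h)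

/-- Norms on the generators of the groups `G_{sⁿω}`, assigning `α n` to `a` and `ν n x` to
the `x`-th of `b, c, d`, that are contracted by a factor `2 / η` at each level. -/
structure ContractingNorm (ω : ℕ → Fin 3) (η : ℝ) where
  /-- the norm of `a` -/
  α : ℕ → ℝ
  /-- the norms of `b, c, d` -/
  ν : ℕ → Fin 3 → ℝ
  /-- a lower bound for the norms of `a` -/
  lower : ℝ
  /-- an upper bound for the norms of `a` -/
  upper : ℝ
  lower_pos : 0 < lower
  lower_le : ∀ n, lower ≤ α n
  le_upper : ∀ n, α n ≤ upper
  nonneg : ∀ n x, 0 ≤ ν n x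
  triangle : ∀ n x y z, x ≠ y → y ≠ z → x ≠ z → ν n x ≤ ν n y + ν n z
  contract_ne : ∀ n x, x ≠ ω n → α (n + 1) + ν (n + 1) x ≤ 2 / η * (α n + ν n x)
  contract_eq : ∀ n, ν (n + 1) (ω n) ≤ 2 / η * (α n + ν n (ω n))

/-- With `α n + ν n x = V n x`, the condition for `x ≠ ω n` is the eigenvector equation, whatever
`α` is. The condition at `ω n` then dictates `α (n + 1) = defect (V n) (ω n) / η`, and both hold
with equality. -/
theorem exists_contractingNorm {ω : ℕ → Fin 3} {k : ℕ} (hk : 0 < k)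
    (hall : ∀ x, ∃ m < k, ω m = x) (hω : ∀ n, ω (n + k) = ω n) {η : ℝ} (hη₂ : 2 < η)
    {V : ℕ → Fin 3 → ℝ} (hV : ∀ n x, 0 < V n x) (hper : ∀ n, V (n + k) = V n)
    (hstep : ∀ n, η • V (n + 1) = stepVec (ω n) (V n)) : Nonempty (ContractingNorm ω η) := by
  have hη0 : 0 < η := by linarith
  have hdef := defect_pos hk hall hω hη₂ hV hper hstep
  obtain ⟨c, C, hc, hcC⟩ := exists_bounds_of_periodic (f := fun n => defect (V n) (ω n)) hk
    (fun n => by simp only [hper, hω]) (fun n => hdef n (ω n))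
  have hval : ∀ n x, V (n + 1) x = stepVec (ω n) (V n) x / η := fun n x => by
    rw [← hstep]; simp [hη0.ne']
  have hlet : ∀ n, ω (n + k - 1 + 1) = ω n := fun n => by
    rw [show n + k - 1 + 1 = n + k by omega, hω]
  have hidx : ∀ n, n + 1 + k - 1 = n + k - 1 + 1 := fun n => by omega
  have hν : ∀ m x, V (m + 1) x - defect (V m) (ω m) / η =
      (stepVec (ω m) (V m) x - defect (V m) (ω m)) / η := fun m x => by rw [hval, sub_div]
  refine ⟨{
    -- By periodicity `n + k - 1` stands for `n - 1`, which also makes sense at `n = 0`.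
    α := fun n => defect (V (n + k - 1)) (ω (n + k - 1)) / η
    ν := fun n x => V (n + k - 1 + 1) x -
      defect (V (n + k - 1)) (ω (n + k - 1)) / η
    lower := c / η
    upper := C / η
    lower_pos := by positivity
    lower_le := fun n => div_le_div_of_nonneg_right (hcC _).1 hη0.le
    le_upper := fun n => div_le_div_of_nonneg_right (hcC _).2 hη0.le
    nonneg := fun n x => ?_
    triangle := fun n x y z hxy hyz hxz => ?_
    contract_ne := fun n x hx => ?_
    contract_eq := fun n => ?_ }⟩
  · rw [hν]
    exact div_nonneg (stepVec_sub_defect_nonneg _ (hV _) (hdef _) x) hη0.le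
  · simp only [hν]
    rw [← add_div]
    refine div_le_div_of_nonneg_right ?_ hη0.le
    linarith [stepVec_sub_defect_triangle (ω (n + k - 1)) (hdef (n + k - 1)) hxy hyz hxz]
  · simp only [hidx]
    rw [add_sub_cancel, add_sub_cancel, hval, stepVec, hlet, if_neg hx]
    apply le_of_eq; ring
  · simp only [hidx]
    rw [hν, hlet, stepVec, if_pos rfl, add_sub_cancel]
    apply le_of_eq
    simp only [defect]
    ring

/-! ### Self-similar transformations

An element `(f, g)` of the wreath product is represented by the transformation
`(ξ, y) ↦ (g ξ, f (g ξ) y)` of `(ℕ → Bool) × A`. -/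

theorem shift_cons {α : Type*} (x : α) (u : ℕ → α) : shift (cons x u) = u := rfl

theorem cons_injective {α : Type*} {x y : α} {u v : ℕ → α} (h : cons x u = cons y v) :
    x = y ∧ u = v :=
  ⟨congrFun h 0, congrArg shift h⟩

section Transformations

variable {A : Type*}

/-- The transformation acting by `h i` on sequences starting with `i`, and then exchanging
the first letters if `b = true`. -/
def node (b : Bool) (h : Bool → (ℕ → Bool) × A → (ℕ → Bool) × A) (z : (ℕ → Bool) × A) :
    (ℕ → Bool) × A :=
  (cons (xor b (z.1 0)) (h (z.1 0) (shift z.1, z.2)).1, (h (z.1 0) (shift z.1, z.2)).2)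

theorem node_comp_node (b c : Bool) (h k : Bool → (ℕ → Bool) × A → (ℕ → Bool) × A) :
    node b h ∘ node c k = node (xor b c) fun i => h (xor c i) ∘ k i := by
  funext z
  simp only [node, Function.comp_apply, shift_cons, cons, Bool.xor_assoc]

variable [Group A]

/-- The transformation representing the pair of `f` and `g`. -/
def wr (f : (ℕ → Bool) → A) (g : (ℕ → Bool) → ℕ → Bool) (z : (ℕ → Bool) × A) :
    (ℕ → Bool) × A :=
  (g z.1, f (g z.1) * z.2)

variable (A) in
/-- The transformation representing `a`. -/
def rootTr : (ℕ → Bool) × A → (ℕ → Bool) × A := wr 1 rootFun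

theorem rootTr_eq_node : rootTr A = node true fun _ => id := by
  funext z
  simp [rootTr, wr, node, rootFun]

theorem rootTr_comp_rootTr : rootTr A ∘ rootTr A = id := by
  funext z
  simp [rootTr, wr, rootFun_rootFun]

/-- The four-group acting on sequences. -/
def fourFun (ω : ℕ → Fin 3) : Option (Fin 3) → (ℕ → Bool) → ℕ → Bool
  | none => id
  | some x => spinalFun x ω

/-- The multiplication of the four-group. -/
def fourMul : Option (Fin 3) → Option (Fin 3) → Option (Fin 3)
  | none, v => v
  | u, none => u
  -- The three indices sum to zero in `Fin 3`, so `-(x + y)` is the third one.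
  | some x, some y => if x = y then none else some (-(x + y))

theorem letterHom_comp (i : Fin 3) {x y : Fin 3} (h : x ≠ y) (ξ : ℕ → Bool) :
    letterHom i x (letterHom i y ξ) = letterHom i (-(x + y)) ξ := by
  have h2 := rootFun_rootFun ξ
  fin_cases i <;> fin_cases x <;> fin_cases y <;> simp at h ⊢ <;>
    simp [letterHom, genA, h2, show (-1 : Fin 3) = 2 from rfl, show (-2 : Fin 3) = 1 from rfl]

theorem spinalFun_comp {x y : Fin 3} (h : x ≠ y) (ω : ℕ → Fin 3) (ξ : ℕ → Bool) :
    spinalFun x ω (spinalFun y ω ξ) = spinalFun (-(x + y)) ω ξ := by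
  funext n
  induction n generalizing ω ξ with
  | zero => simp [spinalFun]
  | succ n ih =>
    rw [← cons_shift ξ]
    cases ξ 0 with
    | false => rw [spinalFun_cons_false, spinalFun_cons_false, spinalFun_cons_false,
        letterHom_comp _ h]
    | true =>
      rw [spinalFun_cons_true, spinalFun_cons_true, spinalFun_cons_true]
      exact ih (shift ω) (shift ξ)

theorem fourFun_fourFun (ω : ℕ → Fin 3) (u v : Option (Fin 3)) (ξ : ℕ → Bool) :
    fourFun ω u (fourFun ω v ξ) = fourFun ω (fourMul u v) ξ := by
  rcases u with _ | x
  · rfl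
  rcases v with _ | y
  · rfl
  simp only [fourMul]
  split_ifs with h
  · subst h; exact spinalFun_spinalFun x ω ξ
  · exact spinalFun_comp h ω ξ

theorem fourFun_self (ω : ℕ → Fin 3) (v : Option (Fin 3)) (ξ : ℕ → Bool) :
    fourFun ω v (fourFun ω v ξ) = ξ := by
  rcases v with _ | x
  · rfl
  · exact spinalFun_spinalFun x ω ξ

/-- Positions close to `ρ`. -/
def nearPos (ω : ℕ → Fin 3) (ρ : ℕ → Bool) (j : Option (Fin 3) × Bool) : ℕ → Bool :=
  fourFun ω j.1 (if j.2 then rootFun ρ else ρ)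

theorem fourFun_mem_nearPos {ω : ℕ → Fin 3} {ρ ξ : ℕ → Bool} (v : Option (Fin 3))
    (h : ξ ∈ Set.range (nearPos ω ρ)) : fourFun ω v ξ ∈ Set.range (nearPos ω ρ) := by
  obtain ⟨⟨u, ε⟩, rfl⟩ := h
  exact ⟨(fourMul v u, ε), (fourFun_fourFun ω v u _).symm⟩

/-- Below the first letter, an element of the four-group acts through the four-group, through `a`,
or trivially. The points `ρ` and `a ρ` have the same tail, so the eight kinds of position suffice at
every level. -/
theorem mem_nearPos_of_cons {ω : ℕ → Fin 3} {ρ ξ : ℕ → Bool} {i : Bool}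
    (h : cons i ξ ∈ Set.range (nearPos ω ρ)) :
    ξ ∈ Set.range (nearPos (shift ω) (shift ρ)) := by
  obtain ⟨⟨u, ε⟩, hu⟩ := h
  have hρ : ∃ j, (if ε then rootFun ρ else ρ) = cons j (shift ρ) := by
    cases ε
    · exact ⟨ρ 0, (cons_shift ρ).symm⟩
    · exact ⟨!(ρ 0), rfl⟩
  obtain ⟨j, hj⟩ := hρ
  simp only [nearPos, hj] at hu
  rcases u with _ | x
  · exact ⟨(none, false), (cons_injective hu).2⟩
  · cases j with
    | true =>
      simp only [fourFun, spinalFun_cons_true] at hu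
      exact ⟨(some x, false), (cons_injective hu).2⟩
    | false =>
      simp only [fourFun, spinalFun_cons_false] at hu
      have h2 := (cons_injective hu).2
      by_cases hx : x = ω 0
      · refine ⟨(none, false), ?_⟩
        simpa [nearPos, fourFun, letterHom, hx] using h2
      · refine ⟨(none, true), ?_⟩
        simpa [nearPos, fourFun, letterHom, hx, genA] using h2

/-- The product of an element of the four-group with a function supported near `ρ`. -/
def IsSlot (ω : ℕ → Fin 3) (ρ : ℕ → Bool) (v : Option (Fin 3))
    (s : (ℕ → Bool) × A → (ℕ → Bool) × A) : Prop :=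
  ∃ f : (ℕ → Bool) → A, (∀ ξ, ξ ∉ Set.range (nearPos ω ρ) → f ξ = 1) ∧ s = wr f (fourFun ω v)

theorem isSlot_id (ω : ℕ → Fin 3) (ρ : ℕ → Bool) :
    IsSlot ω ρ none (id : (ℕ → Bool) × A → (ℕ → Bool) × A) :=
  ⟨1, fun _ _ => rfl, by funext z; simp [wr, fourFun]⟩

theorem IsSlot.comp {ω : ℕ → Fin 3} {ρ : ℕ → Bool} {u v : Option (Fin 3)}
    {s r : (ℕ → Bool) × A → (ℕ → Bool) × A} (hs : IsSlot ω ρ u s) (hr : IsSlot ω ρ v r) :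
    IsSlot ω ρ (fourMul u v) (s ∘ r) := by
  obtain ⟨f, hf, rfl⟩ := hs
  obtain ⟨g, hg, rfl⟩ := hr
  refine ⟨fun ξ => f ξ * g (fourFun ω u ξ), fun ξ hξ => ?_, ?_⟩
  · change f ξ * g (fourFun ω u ξ) = 1
    rw [hf ξ hξ, hg, one_mul]
    intro h
    apply hξ
    simpa [fourFun_self] using fourFun_mem_nearPos u h
  · funext z
    simp only [wr, Function.comp_apply, ← fourFun_fourFun, fourFun_self, mul_assoc]

/-- The image of an element of the four-group under the homomorphism `i`. -/
def letterTr (A : Type*) [Group A] (i : Fin 3) :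
    Option (Fin 3) → (ℕ → Bool) × A → (ℕ → Bool) × A
  | none => id
  | some x => if x = i then id else rootTr A

/-- The wreath recursion for `v`, with the lamps divided between the two subtrees. -/
theorem IsSlot.exists_node {ω : ℕ → Fin 3} {ρ : ℕ → Bool} {v : Option (Fin 3)}
    {s : (ℕ → Bool) × A → (ℕ → Bool) × A} (hs : IsSlot ω ρ v s) :
    ∃ s₁ s₂, IsSlot (shift ω) (shift ρ) none s₁ ∧ IsSlot (shift ω) (shift ρ) v s₂ ∧
      s = node false fun i => if i then s₂ else s₁ ∘ letterTr A (ω 0) v := by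
  obtain ⟨f, hf, rfl⟩ := hs
  refine ⟨wr (fun ξ => f (cons false ξ)) (fourFun (shift ω) none),
    wr (fun ξ => f (cons true ξ)) (fourFun (shift ω) v),
    ⟨_, fun ξ hξ => hf _ fun h => hξ (mem_nearPos_of_cons h), rfl⟩,
    ⟨_, fun ξ hξ => hf _ fun h => hξ (mem_nearPos_of_cons h), rfl⟩, ?_⟩
  funext ⟨ξ, y⟩
  rw [← cons_shift ξ]
  cases ξ 0 with
  | false =>
    rcases v with _ | x
    · simp [wr, node, fourFun, letterTr, cons, shift_cons]
    · by_cases hx : x = ω 0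
      · simp [wr, node, fourFun, letterTr, cons, shift_cons, spinalFun_cons_false, letterHom, hx]
      · simp [wr, node, fourFun, letterTr, cons, shift_cons, spinalFun_cons_false, letterHom, hx,
          rootTr, genA]
  | true =>
    rcases v with _ | x
    · simp [wr, node, fourFun, cons, shift_cons]
    · simp [wr, node, fourFun, cons, shift_cons, spinalFun_cons_true]

/-! ### Norms and their contraction -/

/-- The norm on the four-group. -/
def fourNorm (ν : Fin 3 → ℝ) : Option (Fin 3) → ℝ
  | none => 0
  | some x => ν x

theorem fourNorm_nonneg {ν : Fin 3 → ℝ} (hν : ∀ x, 0 ≤ ν x) (v : Option (Fin 3)) :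
    0 ≤ fourNorm ν v := by
  rcases v with _ | x
  · exact le_rfl
  · exact hν x

theorem fourNorm_fourMul_le {ν : Fin 3 → ℝ} (hν : ∀ x, 0 ≤ ν x)
    (htri : ∀ x y z, x ≠ y → y ≠ z → x ≠ z → ν x ≤ ν y + ν z) (u v : Option (Fin 3)) :
    fourNorm ν (fourMul u v) ≤ fourNorm ν u + fourNorm ν v := by
  rcases u with _ | x
  · simp [fourMul, fourNorm]
  rcases v with _ | y
  · simp [fourMul, fourNorm]
  simp only [fourMul]
  split_ifs with h
  · have := hν x; have := hν y
    simp only [fourNorm]; linarith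
  · have key : ∀ x y : Fin 3, x ≠ y → -(x + y) ≠ x ∧ -(x + y) ≠ y := by decide
    obtain ⟨h1, h2⟩ := key x y h
    exact htri _ _ _ h1 h h2

/-- `Represents ω ρ α ν t h` says that `h` is an alternating product of slots and `a` whose
total norm is at most `t`. -/
inductive Represents (ω : ℕ → Fin 3) (ρ : ℕ → Bool) (α : ℝ) (ν : Fin 3 → ℝ) :
    ℝ → ((ℕ → Bool) × A → (ℕ → Bool) × A) → Prop
  | slot {t : ℝ} {v : Option (Fin 3)} {s : (ℕ → Bool) × A → (ℕ → Bool) × A}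
      (hs : IsSlot ω ρ v s) (ht : fourNorm ν v ≤ t) : Represents ω ρ α ν t s
  | step {t t' : ℝ} {v : Option (Fin 3)} {h s : (ℕ → Bool) × A → (ℕ → Bool) × A}
      (hh : Represents ω ρ α ν t h) (hs : IsSlot ω ρ v s) (ht : t + α + fourNorm ν v ≤ t') :
      Represents ω ρ α ν t' (h ∘ rootTr A ∘ s)

section Represents

variable {ω : ℕ → Fin 3} {ρ : ℕ → Bool} {α : ℝ} {ν : Fin 3 → ℝ} {t t' : ℝ}
  {h s : (ℕ → Bool) × A → (ℕ → Bool) × A}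

theorem Represents.mono (hh : Represents ω ρ α ν t h) (ht : t ≤ t') :
    Represents ω ρ α ν t' h := by
  cases hh with
  | slot hs h1 => exact .slot hs (h1.trans ht)
  | step hh hs h1 => exact .step hh hs (h1.trans ht)

theorem Represents.comp_slot (hν : ∀ x, 0 ≤ ν x)
    (htri : ∀ x y z, x ≠ y → y ≠ z → x ≠ z → ν x ≤ ν y + ν z)
    (hh : Represents ω ρ α ν t h) {v : Option (Fin 3)} (hs : IsSlot ω ρ v s) :
    Represents ω ρ α ν (t + fourNorm ν v) (h ∘ s) := by
  cases hh with
  | @slot _ u _ hr h1 =>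
    refine .slot (hr.comp hs) ?_
    linarith [fourNorm_fourMul_le hν htri u v]
  | @step t₀ _ u h₀ r hh hr h1 =>
    rw [Function.comp_assoc, Function.comp_assoc]
    refine .step hh (hr.comp hs) ?_
    linarith [fourNorm_fourMul_le hν htri u v]

theorem Represents.comp_rootTr (hh : Represents ω ρ α ν t h) :
    Represents ω ρ α ν (t + α) (h ∘ rootTr A) :=
  .step hh (isSlot_id ω ρ) (by simp [fourNorm])

theorem Represents.comp (hν : ∀ x, 0 ≤ ν x)
    (htri : ∀ x y z, x ≠ y → y ≠ z → x ≠ z → ν x ≤ ν y + ν z)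
    {k : (ℕ → Bool) × A → (ℕ → Bool) × A}
    (hh : Represents ω ρ α ν t h) (hk : Represents ω ρ α ν t' k) :
    Represents ω ρ α ν (t + t') (h ∘ k) := by
  induction hk with
  | slot hs h1 => exact (hh.comp_slot hν htri hs).mono (by linarith)
  | step hk hs h1 ih => exact .step ih hs (by linarith)

/-- The contraction of norms under the decomposition. -/
theorem Represents.exists_node {α' : ℝ} {ν' : Fin 3 → ℝ} {q : ℝ} (hq : 0 ≤ q) (hα : 0 ≤ α)
    (hν' : ∀ x, 0 ≤ ν' x)
    (htri : ∀ x y z, x ≠ y → y ≠ z → x ≠ z → ν' x ≤ ν' y + ν' z)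
    (hne : ∀ x, x ≠ ω 0 → α' + ν' x ≤ q * (α + ν x))
    (heq : ν' (ω 0) ≤ q * (α + ν (ω 0)))
    (hh : Represents ω ρ α ν t h) :
    ∃ b h₁ h₂ t₁ t₂, h = node b (fun i => if i then h₂ else h₁) ∧
      Represents (shift ω) (shift ρ) α' ν' t₁ h₁ ∧
      Represents (shift ω) (shift ρ) α' ν' t₂ h₂ ∧ t₁ + t₂ ≤ q * (t + α) := by
  -- Here `c` is the cost of `ω₀(v)` in the component at `1`, while `v` itself costs `fourNorm ν' v`
  -- at `2`. Each slot is charged together with one `a`; the first slot has none, whence the extra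
  -- `α` in the conclusion.
  have hlet : ∀ v, ∃ c, c + fourNorm ν' v ≤ q * (α + fourNorm ν v) ∧
      ∀ {r} {k : (ℕ → Bool) × A → (ℕ → Bool) × A},
        Represents (shift ω) (shift ρ) α' ν' r k →
        Represents (shift ω) (shift ρ) α' ν' (r + c) (k ∘ letterTr A (ω 0) v) := by
    rintro (_ | x)
    · refine ⟨0, by simpa [fourNorm] using mul_nonneg hq hα, fun {r k} hk => by simpa [letterTr]⟩
    · by_cases hx : x = ω 0
      · refine ⟨0, by simpa [fourNorm, hx] using heq, fun {r k} hk => by simpa [letterTr, hx]⟩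
      · refine ⟨α', hne x hx, fun {r k} hk => ?_⟩
        simp only [letterTr, if_neg hx]
        exact hk.comp_rootTr
  induction hh with
  | @slot t v s hs h1 =>
    obtain ⟨s₁, s₂, hs₁, hs₂, rfl⟩ := hs.exists_node
    obtain ⟨c, hc, hcl⟩ := hlet v
    refine ⟨_, _, _, _, _, rfl, hcl (.slot hs₁ le_rfl), .slot hs₂ le_rfl, ?_⟩
    have : q * (α + fourNorm ν v) ≤ q * (t + α) := mul_le_mul_of_nonneg_left (by linarith) hq
    simp only [fourNorm] at *
    linarith
  | @step t t' v h s hh hs h1 ih =>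
    obtain ⟨s₁, s₂, hs₁, hs₂, rfl⟩ := hs.exists_node
    obtain ⟨b, h₁, h₂, t₁, t₂, rfl, hr₁, hr₂, ht⟩ := ih
    obtain ⟨c, hc, hcl⟩ := hlet v
    -- The new `a` exchanges the subtrees, so the components of `h` are crossed.
    refine ⟨!b, h₂ ∘ s₁ ∘ letterTr A (ω 0) v, h₁ ∘ s₂, _, _, ?_,
      hcl (hr₂.comp_slot hν' htri hs₁), hr₁.comp_slot hν' htri hs₂, ?_⟩
    · rw [rootTr_eq_node, node_comp_node, node_comp_node]
      congr 1
      · simp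
      · funext i
        cases i <;> simp
    · have : q * (t + α + fourNorm ν v) ≤ q * t' := mul_le_mul_of_nonneg_left h1 hq
      simp only [fourNorm] at *
      linarith

end Represents

end Transformations

/-! ### Counting by codes -/

section Codes

/-- Perfect binary trees of depth `n` with a list at every leaf and a sign at every other
vertex. -/
def Code (Λ : Type*) : ℕ → Type _
  | 0 => List Λ
  | n + 1 => Bool × Code Λ n × Code Λ n

/-- The total length of the lists in a code. -/
def Code.size {Λ : Type*} : {n : ℕ} → Code Λ n → ℕ
  | 0, l => List.length l
  | _ + 1, c => Code.size c.2.1 + Code.size c.2.2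

open ENNReal in
-- With this weight the lists of length `n` contribute `2⁻ⁿ` in total.
theorem tsum_list_pow {Λ : Type*} [Fintype Λ] [Nonempty Λ] :
    ∑' l : List Λ, ((2 * (Fintype.card Λ : ℝ≥0∞))⁻¹) ^ l.length = 2 := by
  have hβ : (Fintype.card Λ : ℝ≥0∞) ≠ 0 := by simp
  have hβ' : (Fintype.card Λ : ℝ≥0∞) ≠ ∞ := ENNReal.natCast_ne_top _
  rw [← (Equiv.sigmaFiberEquiv (List.length (α := Λ))).tsum_eq, ENNReal.tsum_sigma']
  have h : ∀ n : ℕ, ∑' l : {l : List Λ // l.length = n},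
      ((2 * (Fintype.card Λ : ℝ≥0∞))⁻¹) ^
        ((Equiv.sigmaFiberEquiv (List.length (α := Λ))) ⟨n, l⟩).length = (2⁻¹) ^ n := by
    intro n
    have h1 : ∀ l : {l : List Λ // l.length = n}, ((2 * (Fintype.card Λ : ℝ≥0∞))⁻¹) ^
        ((Equiv.sigmaFiberEquiv (List.length (α := Λ))) ⟨n, l⟩).length =
        ((2 * (Fintype.card Λ : ℝ≥0∞))⁻¹) ^ n := fun l => by
      congr 1; exact l.2
    simp_rw [h1]
    change ∑' _ : List.Vector Λ n, _ = _
    rw [tsum_fintype, Finset.sum_const, Finset.card_univ, card_vector, nsmul_eq_mul,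
      Nat.cast_pow, ← mul_pow, ENNReal.mul_inv (by simp) (by simp), mul_comm, mul_assoc,
      ENNReal.inv_mul_cancel hβ hβ', mul_one]
  simp_rw [h]
  rw [ENNReal.tsum_geometric, ENNReal.one_sub_inv_two, inv_inv]

open ENNReal in
-- The sums satisfy `F (n + 1) = 2 * F n ^ 2`, the 2 coming from the sign, so `2 * F n` is squared
-- at each level.
theorem two_mul_tsum_code_pow {Λ : Type*} [Fintype Λ] [Nonempty Λ] (n : ℕ) :
    2 * ∑' c : Code Λ n, ((2 * (Fintype.card Λ : ℝ≥0∞))⁻¹) ^ c.size = 4 ^ 2 ^ n := by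
  induction n with
  | zero =>
    change 2 * ∑' l : List Λ, ((2 * (Fintype.card Λ : ℝ≥0∞))⁻¹) ^ l.length = _
    rw [tsum_list_pow]; norm_num
  | succ n ih =>
    change 2 * ∑' c : Bool × Code Λ n × Code Λ n,
      ((2 * (Fintype.card Λ : ℝ≥0∞))⁻¹) ^ (c.2.1.size + c.2.2.size) = _
    simp_rw [pow_add]
    rw [ENNReal.tsum_prod', tsum_fintype]
    simp_rw [ENNReal.tsum_prod', ENNReal.tsum_mul_left, ENNReal.tsum_mul_right]
    rw [Finset.sum_const, Finset.card_univ, Fintype.card_bool, pow_one, pow_mul, ← ih]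
    simp only [nsmul_eq_mul, Nat.cast_ofNat]
    ring

open ENNReal in
/-- The number of codes of size at most `M`. -/
theorem card_le_of_code_size_le {Λ B : Type*} [Fintype Λ] [Nonempty Λ] {n M : ℕ} (s : Finset B)
    (code : B → Code Λ n) (hinj : Set.InjOn code s) (hM : ∀ b ∈ s, (code b).size ≤ M) :
    s.card ≤ (2 * Fintype.card Λ) ^ M * 4 ^ 2 ^ n := by
  classical
  set z : ℝ≥0∞ := (2 * (Fintype.card Λ : ℝ≥0∞))⁻¹ with hz
  have hβ : (1 : ℝ≥0∞) ≤ 2 * (Fintype.card Λ : ℝ≥0∞) := by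
    have : 1 ≤ 2 * Fintype.card Λ := by have := Fintype.card_pos (α := Λ); omega
    exact_mod_cast this
  have hz1 : z ≤ 1 := ENNReal.inv_le_one.mpr hβ
  -- Each code of size at most `M` contributes at least `z ^ M` to the generating function.
  have h1 : (s.card : ℝ≥0∞) * z ^ M ≤ 4 ^ 2 ^ n := by
    calc (s.card : ℝ≥0∞) * z ^ M = ∑ b ∈ s, z ^ M := by simp
      _ ≤ ∑ b ∈ s, z ^ (code b).size :=
        Finset.sum_le_sum fun b hb => pow_le_pow_right_of_le_one' hz1 (hM b hb)
      _ = ∑ c ∈ s.image code, z ^ c.size :=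
        (Finset.sum_image (f := fun c : Code Λ n => z ^ c.size) hinj).symm
      _ ≤ ∑' c : Code Λ n, z ^ c.size := ENNReal.sum_le_tsum _
      _ ≤ 2 * ∑' c : Code Λ n, z ^ c.size := le_mul_of_one_le_left' (by norm_num)
      _ = 4 ^ 2 ^ n := two_mul_tsum_code_pow n
  have hzz : z * (2 * (Fintype.card Λ : ℝ≥0∞)) = 1 :=
    ENNReal.inv_mul_cancel (by simp) (by simp [ENNReal.mul_eq_top])
  have h2 : (s.card : ℝ≥0∞) ≤ (2 * (Fintype.card Λ : ℝ≥0∞)) ^ M * 4 ^ 2 ^ n := by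
    calc (s.card : ℝ≥0∞) = (s.card * z ^ M) * (2 * (Fintype.card Λ : ℝ≥0∞)) ^ M := by
          rw [mul_assoc, ← mul_pow, hzz, one_pow, mul_one]
      _ ≤ 4 ^ 2 ^ n * (2 * (Fintype.card Λ : ℝ≥0∞)) ^ M := by gcongr
      _ = _ := mul_comm _ _
  exact_mod_cast h2

end Codes

/-! ### Encoding transformations by trees of lists -/

section Eval

variable {A : Type*} [Group A]

/-- The parameters of a slot: the values near `ρ` and the element of the four-group. -/
abbrev SlotData (A : Type*) := (Option (Fin 3) × Bool → A) × Option (Fin 3)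

open Classical in
/-- The slot with the given parameters. -/
noncomputable def evalSlot (ω : ℕ → Fin 3) (ρ : ℕ → Bool) (d : SlotData A) :
    (ℕ → Bool) × A → (ℕ → Bool) × A :=
  wr (fun ξ => if h : ∃ j, nearPos ω ρ j = ξ then d.1 h.choose else 1) (fourFun ω d.2)

theorem IsSlot.exists_evalSlot {ω : ℕ → Fin 3} {ρ : ℕ → Bool} {v : Option (Fin 3)}
    {s : (ℕ → Bool) × A → (ℕ → Bool) × A} (hs : IsSlot ω ρ v s) :
    ∃ d : SlotData A, evalSlot ω ρ d = s := by
  obtain ⟨f, hf, rfl⟩ := hs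
  refine ⟨(fun j => f (nearPos ω ρ j), v), ?_⟩
  unfold evalSlot
  congr 1
  funext ξ
  split_ifs with h
  · exact congrArg f h.choose_spec
  · exact (hf ξ h).symm

/-- The alternating product of `a` and a list of slots, from right to left. -/
noncomputable def evalList (ω : ℕ → Fin 3) (ρ : ℕ → Bool) :
    List (SlotData A) → (ℕ → Bool) × A → (ℕ → Bool) × A
  -- The `a` here cancels the superfluous `a` in front of the last slot of a nonempty list.
  | [] => rootTr A
  | d :: l => evalList ω ρ l ∘ rootTr A ∘ evalSlot ω ρ d

/-- The transformation described by a code. -/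
noncomputable def evalCode : (n : ℕ) → (ω : ℕ → Fin 3) → (ρ : ℕ → Bool) →
    Code (SlotData A) n → (ℕ → Bool) × A → (ℕ → Bool) × A
  | 0, ω, ρ, l => evalList ω ρ l
  | n + 1, ω, ρ, c => node c.1 fun i =>
      if i then evalCode n (shift ω) (shift ρ) c.2.2 else evalCode n (shift ω) (shift ρ) c.2.1

theorem Represents.exists_list {ω : ℕ → Fin 3} {ρ : ℕ → Bool} {α : ℝ} {ν : Fin 3 → ℝ} {t : ℝ}
    {h : (ℕ → Bool) × A → (ℕ → Bool) × A} {c : ℝ} (hc : c ≤ α) (hν : ∀ x, 0 ≤ ν x)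
    (hh : Represents ω ρ α ν t h) :
    ∃ l : List (SlotData A), evalList ω ρ l = h ∧ l.length * c ≤ t + c := by
  induction hh with
  | @slot t v s hs h1 =>
    obtain ⟨d, rfl⟩ := hs.exists_evalSlot
    refine ⟨[d], ?_, ?_⟩
    · simp only [evalList]
      rw [← Function.comp_assoc, rootTr_comp_rootTr, Function.id_comp]
    · have := fourNorm_nonneg hν v
      simp; linarith
  | @step t t' v h s hh hs h1 ih =>
    obtain ⟨d, rfl⟩ := hs.exists_evalSlot
    obtain ⟨l, rfl, hl⟩ := ih
    refine ⟨d :: l, rfl, ?_⟩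
    have := fourNorm_nonneg hν v
    push_cast [List.length_cons]
    linarith

theorem shift_iterate_apply {α : Type*} (m : ℕ) (u : ℕ → α) : shift^[m] u 0 = u m := by
  have : ∀ n, shift^[m] u n = u (n + m) := by
    induction m with
    | zero => intro n; rfl
    | succ m ih =>
      intro n
      rw [Function.iterate_succ_apply']
      simp only [shift, ih]
      ring_nf
  simpa using this 0

/-- Iterated contraction: each vertex and each leaf adds a bounded error, for a total of order `2 ^
n`. The negative term gives the slack that closes the induction. -/
theorem Represents.exists_code {ω : ℕ → Fin 3} {η : ℝ} (hη₂ : 2 < η) (N : ContractingNorm ω η)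
    (ρ : ℕ → Bool) (n m : ℕ) {t : ℝ} {h : (ℕ → Bool) × A → (ℕ → Bool) × A}
    (hh : Represents (shift^[m] ω) (shift^[m] ρ) (N.α m) (N.ν m) t h) :
    ∃ c : Code (SlotData A) n, evalCode n (shift^[m] ω) (shift^[m] ρ) c = h ∧
      c.size * N.lower ≤ (2 / η) ^ n * t + N.upper * (2 * 2 ^ n - (2 / η) ^ n) := by
  have hlu : N.lower ≤ N.upper := (N.lower_le 0).trans (N.le_upper 0)
  have hl := N.lower_pos
  induction n generalizing m t h with
  | zero =>
    obtain ⟨l, hl, hlen⟩ := hh.exists_list (N.lower_le m) (N.nonneg m)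
    refine ⟨l, hl, ?_⟩
    change (l.length : ℝ) * _ ≤ _
    simp only [pow_zero]
    linarith
  | succ n ih =>
    have hq : 0 ≤ 2 / η := by positivity
    have hq1 : 2 / η ≤ 1 := by rw [div_le_one (by linarith)]; exact hη₂.le
    have hα : 0 ≤ N.α m := hl.le.trans (N.lower_le m)
    obtain ⟨b, h₁, h₂, t₁, t₂, rfl, hr₁, hr₂, ht⟩ := hh.exists_node hq hα (N.nonneg (m + 1))
      (N.triangle (m + 1)) (by rw [shift_iterate_apply]; exact N.contract_ne m)
      (by rw [shift_iterate_apply]; exact N.contract_eq m)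
    rw [← Function.iterate_succ_apply' shift, ← Function.iterate_succ_apply' shift] at hr₁ hr₂
    obtain ⟨c₁, hc₁, hs₁⟩ := ih (m + 1) hr₁
    obtain ⟨c₂, hc₂, hs₂⟩ := ih (m + 1) hr₂
    refine ⟨(b, c₁, c₂), ?_, ?_⟩
    · simp only [evalCode, ← Function.iterate_succ_apply' shift]
      rw [hc₁, hc₂]
    · have hsize : ((Code.size (n := n + 1) (b, c₁, c₂) : ℕ) : ℝ) = c₁.size + c₂.size := by
        exact_mod_cast (rfl : Code.size (n := n + 1) (b, c₁, c₂) = c₁.size + c₂.size)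
      rw [hsize, pow_succ, pow_succ]
      have hp : 0 ≤ (2 / η) ^ n := by positivity
      have h1 : (2 / η) ^ n * (t₁ + t₂) ≤ (2 / η) ^ n * (2 / η * (t + N.upper)) := by
        refine mul_le_mul_of_nonneg_left (ht.trans ?_) hp
        exact mul_le_mul_of_nonneg_left (by linarith [N.le_upper m]) hq
      have h2 : (2 / η) ^ n * (2 / η) * N.upper ≤ (2 / η) ^ n * N.upper :=
        mul_le_mul_of_nonneg_right (mul_le_of_le_one_right hp hq1) (by linarith)
      linarith

/-- The number of transformations of norm at most `t`. -/
theorem card_le_of_represents [Finite A] {ω : ℕ → Fin 3} {η : ℝ} (hη₂ : 2 < η)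
    (N : ContractingNorm ω η) (ρ : ℕ → Bool) :
    ∃ C : ℝ, 0 < C ∧ ∀ {B : Type _} (s : Finset B) (Φ : B → (ℕ → Bool) × A → (ℕ → Bool) × A)
      (n : ℕ) (t : ℝ), Function.Injective Φ → 0 ≤ t →
      (∀ b ∈ s, Represents ω ρ (N.α 0) (N.ν 0) t (Φ b)) →
      (s.card : ℝ) ≤ Real.exp (C * ((2 / η) ^ n * t + 2 ^ n)) := by
  classical
  have := Fintype.ofFinite A
  have hlu : N.lower ≤ N.upper := (N.lower_le 0).trans (N.le_upper 0)
  have hl := N.lower_pos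
  have hu : 0 < N.upper := hl.trans_le hlu
  set β : ℝ := 2 * Fintype.card (SlotData A) with hβ
  have hβ1 : 1 ≤ β := by
    have : 1 ≤ Fintype.card (SlotData A) := Fintype.card_pos
    have : (1 : ℝ) ≤ Fintype.card (SlotData A) := by exact_mod_cast this
    linarith
  have hlogβ : 0 ≤ Real.log β := Real.log_nonneg hβ1
  have hlog4 : 0 < Real.log 4 := Real.log_pos (by norm_num)
  set D : ℝ := Real.log β / N.lower with hD
  have hD0 : 0 ≤ D := by positivity
  refine ⟨D + D * (2 * N.upper) + Real.log 4, by positivity, ?_⟩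
  intro B s Φ n t hΦ ht hs
  have hp : 0 ≤ (2 / η) ^ n := by positivity
  have hcode : ∀ b : B, ∃ c : Code (SlotData A) n, b ∈ s → evalCode n ω ρ c = Φ b ∧
      c.size * N.lower ≤ (2 / η) ^ n * t + N.upper * (2 * 2 ^ n - (2 / η) ^ n) := fun b => by
    by_cases hb : b ∈ s
    · obtain ⟨c, hc⟩ := Represents.exists_code hη₂ N ρ n 0 (hs b hb)
      exact ⟨c, fun _ => hc⟩
    -- Outside `s` any code will do.
    · have c : Code (SlotData A) n := by
        clear hs
        induction n with
        | zero => exact ([] : List (SlotData A))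
        | succ n ih => exact (true, ih (by positivity), ih (by positivity))
      exact ⟨c, fun h => absurd h hb⟩
  choose code hcode using hcode
  set T : ℝ := (2 / η) ^ n * t + 2 * N.upper * 2 ^ n with hT
  have hT0 : 0 ≤ T := by positivity
  have hM : ∀ b ∈ s, (code b).size ≤ ⌊T / N.lower⌋₊ := fun b hb => by
    apply Nat.le_floor
    rw [le_div_iff₀ hl]
    have h1 := (hcode b hb).2
    have h2 : 0 ≤ N.upper * (2 / η) ^ n := by positivity
    rw [hT]; linarith
  have hcard := card_le_of_code_size_le s code (fun b hb b' hb' h => hΦ (by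
    rw [← (hcode b hb).1, ← (hcode b' hb').1, h])) hM
  have hcard' : (s.card : ℝ) ≤ β ^ ⌊T / N.lower⌋₊ * 4 ^ 2 ^ n := by
    rw [hβ]; exact_mod_cast hcard
  refine hcard'.trans ?_
  have e1 : β ^ ⌊T / N.lower⌋₊ ≤ Real.exp (D * T) := by
    rw [← Real.exp_log (show (0 : ℝ) < β ^ ⌊T / N.lower⌋₊ by positivity), Real.log_pow]
    apply Real.exp_le_exp.mpr
    calc (⌊T / N.lower⌋₊ : ℝ) * Real.log β ≤ T / N.lower * Real.log β :=
          mul_le_mul_of_nonneg_right (Nat.floor_le (by positivity)) hlogβ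
      _ = D * T := by rw [hD]; ring
  have e2 : (4 : ℝ) ^ 2 ^ n = Real.exp (Real.log 4 * 2 ^ n) := by
    rw [← Real.exp_log (show (0 : ℝ) < 4 ^ 2 ^ n by positivity), Real.log_pow]
    push_cast; ring_nf
  rw [e2]
  refine (mul_le_mul_of_nonneg_right e1 (Real.exp_pos _).le).trans ?_
  rw [← Real.exp_add]
  apply Real.exp_le_exp.mpr
  rw [hT]
  have e3 : 0 ≤ D * (2 * N.upper) * ((2 / η) ^ n * t) := by positivity
  have e4 : 0 ≤ Real.log 4 * ((2 / η) ^ n * t) := by positivity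
  have e5 : 0 ≤ D * 2 ^ n := by positivity
  linarith

end Eval

/-! ### Words with large orbits -/

/-- The substitution `ax ↦ ay ax az` for `x = i`, where `y, z` are the other letters, and
`ay ↦ ay ay` for `y ≠ i`. -/
def subst (i x : Fin 3) : List (Fin 3) := if x = i then [i + 1, i, i + 2] else [x, x]

/-- The product of the elements `a x`, for the letters `x` of a word. -/
def evalWord (ω : ℕ → Fin 3) : List (Fin 3) → (ℕ → Bool) → ℕ → Bool
  | [], ξ => ξ
  | x :: w, ξ => rootFun (spinalFun x ω (evalWord ω w ξ))

theorem evalWord_append (ω : ℕ → Fin 3) (u v : List (Fin 3)) (ξ : ℕ → Bool) :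
    evalWord ω (u ++ v) ξ = evalWord ω u (evalWord ω v ξ) := by
  induction u with
  | nil => rfl
  | cons x u ih => simp only [List.cons_append, evalWord, ih]

theorem rootFun_cons (i : Bool) (ξ : ℕ → Bool) : rootFun (cons i ξ) = cons (!i) ξ := rfl

theorem spinalFun_cons_false_of_ne {x : Fin 3} {ω : ℕ → Fin 3} (h : x ≠ ω 0) (ξ : ℕ → Bool) :
    spinalFun x ω (cons false ξ) = cons false (rootFun ξ) := by
  rw [spinalFun_cons_false]; simp [letterHom, h, genA]

theorem spinalFun_cons_false_self (ω : ℕ → Fin 3) (ξ : ℕ → Bool) :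
    spinalFun (ω 0) ω (cons false ξ) = cons false ξ := by
  rw [spinalFun_cons_false]; simp [letterHom]

/-- From `2ξ`, the outer letters act below `2` and multiply to `ω 0`, while the middle letter acts
trivially below `1`. From `1ξ`, the outer letters act as `a` and the middle one as itself. -/
theorem evalWord_subst_self (ω : ℕ → Fin 3) (ξ : ℕ → Bool) :
    evalWord ω (subst (ω 0) (ω 0)) (cons true ξ) =
      cons false (spinalFun (ω 0) (shift ω) ξ) ∧
    evalWord ω (subst (ω 0) (ω 0)) (cons false ξ) =
      cons true (rootFun (spinalFun (ω 0) (shift ω) (rootFun ξ))) := by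
  have h1 : ω 0 + 1 ≠ ω 0 := by simp
  have h2 : ω 0 + 2 ≠ ω 0 := by simp
  have h3 : ω 0 + 1 ≠ ω 0 + 2 := by generalize ω 0 = i; revert i; decide
  have h4 : -(ω 0 + 1 + (ω 0 + 2)) = ω 0 := by generalize ω 0 = i; revert i; decide
  constructor
  · simp only [subst, if_true, evalWord, spinalFun_cons_true, rootFun_cons, Bool.not_true,
      spinalFun_cons_false_self, Bool.not_false, spinalFun_comp h3, h4]
  · simp only [subst, if_true, evalWord, spinalFun_cons_true, rootFun_cons, Bool.not_true,
      spinalFun_cons_false_of_ne h1, spinalFun_cons_false_of_ne h2, Bool.not_false]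

theorem evalWord_subst_of_ne {ω : ℕ → Fin 3} {x : Fin 3} (h : x ≠ ω 0) (ξ : ℕ → Bool) :
    evalWord ω (subst (ω 0) x) (cons true ξ) =
      cons true (rootFun (spinalFun x (shift ω) ξ)) ∧
    evalWord ω (subst (ω 0) x) (cons false ξ) =
      cons false (spinalFun x (shift ω) (rootFun ξ)) := by
  constructor
  · simp only [subst, if_neg h, evalWord, spinalFun_cons_true, rootFun_cons, Bool.not_true,
      spinalFun_cons_false_of_ne h, Bool.not_false]
  · simp only [subst, if_neg h, evalWord, spinalFun_cons_true, rootFun_cons, Bool.not_true,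
      spinalFun_cons_false_of_ne h, Bool.not_false]

/-- The decomposition of the image of a word under the substitution; it depends on the
parity of the number of letters `ω 0`. -/
theorem evalWord_flatMap_subst (ω : ℕ → Fin 3) (w : List (Fin 3)) :
    (∀ ξ, evalWord ω (w.flatMap (subst (ω 0))) (cons true ξ) =
        cons true (evalWord (shift ω) w ξ) ∧
      evalWord ω (w.flatMap (subst (ω 0))) (cons false ξ) =
        cons false (rootFun (evalWord (shift ω) w (rootFun ξ)))) ∨
    (∀ ξ, evalWord ω (w.flatMap (subst (ω 0))) (cons false ξ) =
        cons true (evalWord (shift ω) w (rootFun ξ)) ∧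
      evalWord ω (w.flatMap (subst (ω 0))) (cons true ξ) =
        cons false (rootFun (evalWord (shift ω) w ξ))) := by
  induction w with
  | nil => left; intro ξ; simp [evalWord, rootFun_rootFun]
  | cons x w ih =>
    simp only [List.flatMap_cons, evalWord_append]
    by_cases hx : x = ω 0
    · subst hx
      rcases ih with ih | ih
      · right; intro ξ
        rw [(ih ξ).1, (ih ξ).2, (evalWord_subst_self ω _).1, (evalWord_subst_self ω _).2]
        simp [evalWord, rootFun_rootFun]
      · left; intro ξ
        rw [(ih ξ).1, (ih ξ).2, (evalWord_subst_self ω _).1, (evalWord_subst_self ω _).2]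
        simp [evalWord, rootFun_rootFun]
    · rcases ih with ih | ih
      · left; intro ξ
        rw [(ih ξ).1, (ih ξ).2, (evalWord_subst_of_ne hx _).1, (evalWord_subst_of_ne hx _).2]
        simp [evalWord, rootFun_rootFun]
      · right; intro ξ
        rw [(ih ξ).1, (ih ξ).2, (evalWord_subst_of_ne hx _).1, (evalWord_subst_of_ne hx _).2]
        simp [evalWord, rootFun_rootFun]

/-- The images of `ρ` and `a ρ` under the nonempty proper prefixes of a word. -/
def trace (ω : ℕ → Fin 3) (w : List (Fin 3)) (ρ : ℕ → Bool) : Set (ℕ → Bool) :=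
  {q | ∃ u v, u ≠ [] ∧ v ≠ [] ∧ w = u ++ v ∧ (q = evalWord ω u ρ ∨ q = evalWord ω u (rootFun ρ))}

theorem mem_trace_of_prefix {ω : ℕ → Fin 3} {w : List (Fin 3)} {ρ : ℕ → Bool}
    {u v : List (Fin 3)} (hu : u ≠ []) (hv : v ≠ []) (hw : w = u ++ v) (i : Bool) :
    evalWord ω u (cons i (shift ρ)) ∈ trace ω w ρ := by
  refine ⟨u, v, hu, hv, hw, ?_⟩
  by_cases h : i = ρ 0
  · left; rw [h, cons_shift]
  · right
    have : i = !(ρ 0) := by cases i <;> cases h' : ρ 0 <;> simp_all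
    rw [this]; rfl

theorem subst_eq_cons (i x : Fin 3) : ∃ y l, subst i x = y :: l ∧ l ≠ [] ∧ y ≠ i := by
  by_cases h : x = i
  · exact ⟨i + 1, [i, i + 2], by simp [subst, h], by simp, by simp⟩
  · exact ⟨x, [x], by simp [subst, h], by simp, h⟩

theorem subst_eq_append (i x : Fin 3) : ∃ l z, subst i x = l ++ [z] ∧ l ≠ [] ∧ z ≠ i := by
  by_cases h : x = i
  · exact ⟨[i + 1, i], i + 2, by simp [subst, h], by simp, by simp⟩
  · exact ⟨[x], x, by simp [subst, h], by simp, h⟩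

/-- The image `Z` of a prefix sends `1ξ` and `2ξ` to two of the four points required for `q` ranging
over both images of `ξ` and `a ξ`. The other two come from making `Z` one letter longer or shorter,
which stays within nonempty proper prefixes. -/
theorem mem_trace_flatMap_subst {ω : ℕ → Fin 3} {w : List (Fin 3)} {ρ q : ℕ → Bool}
    (hq : q ∈ trace (shift ω) w (shift ρ)) :
    cons true q ∈ trace ω (w.flatMap (subst (ω 0))) ρ ∧
      cons false (rootFun q) ∈ trace ω (w.flatMap (subst (ω 0))) ρ := by
  obtain ⟨u, v, hu, hv, rfl, hq⟩ := hq
  set ξ := shift ρ with hξ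
  set Z := u.flatMap (subst (ω 0)) with hZ
  obtain ⟨x, v, rfl⟩ := List.exists_cons_of_ne_nil hv
  obtain ⟨y, l, hy, hl, hyne⟩ := subst_eq_cons (ω 0) x
  obtain ⟨u₀, x', rfl⟩ := (List.eq_nil_or_concat u).resolve_left hu
  obtain ⟨l', z, hz, hl', hzne⟩ := subst_eq_append (ω 0) x'
  set Z₀ := u₀.flatMap (subst (ω 0)) ++ l' with hZ₀
  have hZZ : Z = Z₀ ++ [z] := by
    rw [hZ, hZ₀, List.append_assoc, ← hz]; simp [List.flatMap_append]
  have hZ₀ne : Z₀ ≠ [] := by rw [hZ₀]; simp [hl']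
  have hfull : (u₀.concat x' ++ x :: v).flatMap (subst (ω 0)) =
      Z ++ (y :: l ++ v.flatMap (subst (ω 0))) := by
    rw [List.flatMap_append, ← hZ, List.flatMap_cons, hy]
  have m1 : ∀ i, evalWord ω Z (cons i ξ) ∈
      trace ω ((u₀.concat x' ++ x :: v).flatMap (subst (ω 0))) ρ :=
    mem_trace_of_prefix (by rw [hZZ]; simp) (by simp) hfull
  -- The letter `y` following `Z` is not `ω 0`, so `ay` sends `1ξ` to `2(a ξ)`.
  have m2 : evalWord ω Z (cons true (rootFun ξ)) ∈
      trace ω ((u₀.concat x' ++ x :: v).flatMap (subst (ω 0))) ρ := by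
    have h := mem_trace_of_prefix (ω := ω) (ρ := ρ) (u := Z ++ [y])
      (v := l ++ v.flatMap (subst (ω 0))) (by simp) (by simp [hl]) (hfull.trans (by simp)) false
    rw [evalWord_append] at h
    simpa [evalWord, spinalFun_cons_false_of_ne hyne, rootFun_cons] using h
  -- The last letter `z` of `Z` is not `ω 0`, so `az` sends `1(a ξ)` to `2ξ`.
  have m3 : evalWord ω Z (cons false (rootFun ξ)) ∈
      trace ω ((u₀.concat x' ++ x :: v).flatMap (subst (ω 0))) ρ := by
    have h := mem_trace_of_prefix (ω := ω) (ρ := ρ) (u := Z₀)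
      (v := z :: (y :: l ++ v.flatMap (subst (ω 0)))) hZ₀ne (by simp)
      (hfull.trans (by rw [hZZ]; simp)) true
    have h2 : evalWord ω Z (cons false (rootFun ξ)) = evalWord ω Z₀ (cons true ξ) := by
      rw [hZZ, evalWord_append]
      simp [evalWord, spinalFun_cons_false_of_ne hzne, rootFun_cons, rootFun_rootFun]
    rwa [h2]
  rcases evalWord_flatMap_subst ω (u₀.concat x') with hd | hd <;> rw [← hZ] at hd
  · have e1 := (hd ξ).1; have e2 := (hd ξ).2
    have e3 := (hd (rootFun ξ)).1; have e4 := (hd (rootFun ξ)).2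
    rw [rootFun_rootFun] at e4
    rcases hq with rfl | rfl
    · exact ⟨e1 ▸ m1 true, e4 ▸ m3⟩
    · exact ⟨e3 ▸ m2, e2 ▸ m1 false⟩
  · have e1 := (hd ξ).1; have e2 := (hd ξ).2
    have e3 := (hd (rootFun ξ)).1; have e4 := (hd (rootFun ξ)).2
    rw [rootFun_rootFun] at e3
    rcases hq with rfl | rfl
    · exact ⟨e3 ▸ m3, e2 ▸ m1 true⟩
    · exact ⟨e1 ▸ m1 false, e4 ▸ m2⟩

theorem trace_finite (ω : ℕ → Fin 3) (w : List (Fin 3)) (ρ : ℕ → Bool) :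
    (trace ω w ρ).Finite := by
  have h : trace ω w ρ ⊆ (fun u => evalWord ω u ρ) '' {u | u ∈ w.inits} ∪
      (fun u => evalWord ω u (rootFun ρ)) '' {u | u ∈ w.inits} := by
    rintro q ⟨u, v, -, -, rfl, hq⟩
    have hmem : u ∈ (u ++ v).inits := by simp
    rcases hq with rfl | rfl
    · exact Or.inl ⟨u, hmem, rfl⟩
    · exact Or.inr ⟨u, hmem, rfl⟩
  exact (((w.inits.finite_toSet).image _).union ((w.inits.finite_toSet).image _)).subset h

theorem two_mul_ncard_trace_le (ω : ℕ → Fin 3) (w : List (Fin 3)) (ρ : ℕ → Bool) :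
    2 * (trace (shift ω) w (shift ρ)).ncard ≤ (trace ω (w.flatMap (subst (ω 0))) ρ).ncard := by
  set T := trace (shift ω) w (shift ρ) with hT
  have hTf : T.Finite := trace_finite _ _ _
  have hsub : cons true '' T ∪ (fun q => cons false (rootFun q)) '' T ⊆
      trace ω (w.flatMap (subst (ω 0))) ρ := by
    rintro _ (⟨q, hq, rfl⟩ | ⟨q, hq, rfl⟩)
    · exact (mem_trace_flatMap_subst hq).1
    · exact (mem_trace_flatMap_subst hq).2
  refine le_trans ?_ (Set.ncard_le_ncard hsub (trace_finite _ _ _))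
  rw [Set.ncard_union_eq ?_ (hTf.image _) (hTf.image _), Set.ncard_image_of_injective,
    Set.ncard_image_of_injective, two_mul]
  · intro p q h
    have := congrArg rootFun (cons_injective h).2
    simpa [rootFun_rootFun] using this
  · intro p q h
    exact (cons_injective h).2
  · rw [Set.disjoint_left]
    rintro _ ⟨p, -, rfl⟩ ⟨q, -, hq⟩
    simpa using (cons_injective hq).1

theorem sum_subst (i x : Fin 3) (v : Fin 3 → ℝ) :
    ((subst i x).map v).sum = stepVec i v x := by
  unfold subst stepVec
  split_ifs
  · fin_cases i <;> simp [show (1 : Fin 3) + 2 = 0 from rfl, show (2 : Fin 3) + 2 = 1 from rfl] <;>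
      ring
  · simp; ring

/-- There are words of length at most a constant times `ηⁿ` with at least `2ⁿ` points
in their trace. -/
theorem exists_word (ω : ℕ → Fin 3) {η : ℝ} {V : ℕ → Fin 3 → ℝ}
    (hstep : ∀ n, η • V (n + 1) = stepVec (ω n) (V n)) (ρ : ℕ → Bool) (n m : ℕ) :
    ∃ w : List (Fin 3), 2 ^ n ≤ (trace (shift^[m] ω) w (shift^[m] ρ)).ncard ∧
      (w.map (V m)).sum = η ^ n * (2 * V (m + n) 0) := by
  induction n generalizing m with
  | zero =>
    -- Two letters are needed for a nonempty proper prefix; this is the 2 in the weight.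
    refine ⟨[0, 0], ?_, by simp; ring⟩
    rw [pow_zero]
    refine Nat.succ_le_of_lt ((Set.ncard_pos (trace_finite _ _ _)).2 ?_)
    exact ⟨_, [0], [0], by simp, by simp, rfl, Or.inl rfl⟩
  | succ n ih =>
    obtain ⟨w, hw, hsum⟩ := ih (m + 1)
    rw [Function.iterate_succ_apply', Function.iterate_succ_apply'] at hw
    refine ⟨w.flatMap (subst (ω m)), ?_, ?_⟩
    · have h := two_mul_ncard_trace_le (shift^[m] ω) w (shift^[m] ρ)
      rw [shift_iterate_apply] at h
      rw [pow_succ]; omega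
    · have hmap : ∀ l : List (Fin 3), ((l.flatMap (subst (ω m))).map (V m)).sum =
          η * (l.map (V (m + 1))).sum := by
        intro l
        induction l with
        | nil => simp
        | cons x l ih =>
          rw [List.flatMap_cons, List.map_append, List.sum_append, ih, sum_subst, ← hstep]
          simp [mul_add]
      rw [hmap, hsum, show m + 1 + n = m + (n + 1) by ring]
      ring

/-! ### Generators of the wreath product -/

section Lamps

variable {A G X : Type*} [Group A] [Group G] [MulAction G X]

open Classical in
/-- The function on `X` with value `y` on the finite set `U` and `1` elsewhere. -/
noncomputable def indicatorFun (y : A) (U : Finset X) : finSuppFun X A :=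
  ⟨fun x => if x ∈ U then y else 1, U.finite_toSet.subset fun x hx => by
    by_contra h
    exact hx (if_neg h)⟩

open Classical in
theorem indicatorFun_apply (y : A) (U : Finset X) (x : X) :
    (indicatorFun y U).1 x = if x ∈ U then y else 1 := rfl

theorem permAction_apply (g : G) (f : finSuppFun X A) (x : X) :
    (permAction A G X g f).1 x = f.1 (g⁻¹ • x) := rfl

variable (G) in
/-- The element of the wreath product with value `y` at `x`. -/
noncomputable def lamp (x : X) (y : A) : PermWreath A G X :=
  SemidirectProduct.inl (indicatorFun y {x})

theorem inr_mul_lamp_mul_inr_inv (g : G) (x : X) (y : A) :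
    (SemidirectProduct.inr g : PermWreath A G X) * lamp G x y * SemidirectProduct.inr g⁻¹ =
      lamp G (g • x) y := by
  rw [lamp, ← SemidirectProduct.inl_aut, lamp]
  congr 1
  ext p
  have h : g⁻¹ • p ∈ ({x} : Finset X) ↔ p ∈ ({g • x} : Finset X) := by
    rw [Finset.mem_singleton, Finset.mem_singleton, inv_smul_eq_iff]
  rw [permAction_apply, indicatorFun_apply, indicatorFun_apply]
  by_cases hp : p ∈ ({g • x} : Finset X)
  · rw [if_pos hp, if_pos (h.mpr hp)]
  · rw [if_neg hp, if_neg (mt h.mp hp)]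

theorem inl_mem_of_lamp_mem (M : Submonoid (PermWreath A G X)) (h : ∀ x y, lamp G x y ∈ M)
    (f : finSuppFun X A) : (SemidirectProduct.inl f : PermWreath A G X) ∈ M := by
  classical
  have key : ∀ (U : Finset X) (f : finSuppFun X A), (∀ x, x ∉ U → f.1 x = 1) →
      (SemidirectProduct.inl f : PermWreath A G X) ∈ M := by
    intro U
    induction U using Finset.induction_on with
    | empty =>
      intro f hf
      have : f = 1 := by ext x; exact hf x (by simp)
      rw [this, map_one]
      exact M.one_mem
    | insert x U hx ih =>
      intro f hf
      have hmul : f = indicatorFun (f.1 x) {x} * ((indicatorFun (f.1 x) {x})⁻¹ * f) := by simp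
      rw [hmul, map_mul]
      refine M.mul_mem (h x (f.1 x)) (ih _ fun p hp => ?_)
      change ((indicatorFun (f.1 x) {x}).1 p)⁻¹ * f.1 p = 1
      rw [indicatorFun_apply]
      by_cases hpx : p = x
      · simp [hpx]
      · simp [hpx, hf p (by simp [hpx, hp])]
  have hf : (Function.mulSupport f.1).Finite := f.2
  exact key hf.toFinset f fun x hx => by
    by_contra hne
    exact hx (hf.mem_toFinset.mpr hne)

end Lamps

section Generators

variable (A : Type*) [Group A] (ω : ℕ → Fin 3) (ρ : ℕ → Bool)

/-- The generator `a` of the Grigorchuk group. -/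
def rootElt : grigorchukGroup ω := ⟨genA, Subgroup.subset_closure (Or.inl rfl)⟩

/-- The generators `b, c, d` of the Grigorchuk group. -/
def spinalElt (x : Fin 3) : grigorchukGroup ω :=
  ⟨genBCD ω x, Subgroup.subset_closure (Or.inr ⟨x, rfl⟩)⟩

/-- The base point of the orbit. -/
def basePt : orbitX ω ρ := ⟨ρ, MulAction.mem_orbit_self ρ⟩

/-- The standard generators of the wreath product. -/
def standardGen : Set (WGroup A ω ρ) :=
  {SemidirectProduct.inr (rootElt ω)} ∪
    (Set.range (fun x => SemidirectProduct.inr (spinalElt ω x)) ∪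
      Set.range (lamp (grigorchukGroup ω) (basePt ω ρ)))

variable {A ω ρ}

theorem standardGen_finite [Finite A] : (standardGen A ω ρ).Finite :=
  (Set.finite_singleton _).union ((Set.finite_range _).union (Set.finite_range _))

theorem root_mem : (SemidirectProduct.inr (rootElt ω) : WGroup A ω ρ) ∈ standardGen A ω ρ :=
  Or.inl rfl

theorem spinal_mem (x : Fin 3) :
    (SemidirectProduct.inr (spinalElt ω x) : WGroup A ω ρ) ∈ standardGen A ω ρ :=
  Or.inr (Or.inl ⟨x, rfl⟩)

theorem lamp_mem (y : A) : lamp (grigorchukGroup ω) (basePt ω ρ) y ∈ standardGen A ω ρ :=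
  Or.inr (Or.inr ⟨y, rfl⟩)

/-- The generators `a, b, c, d` are involutions, so inverses come for free, and conjugation carries
the lamps at `ρ` to every point of its orbit. -/
theorem closure_standardGen : Submonoid.closure (standardGen A ω ρ) = ⊤ := by
  set M := Submonoid.closure (standardGen A ω ρ) with hM
  have hsub : ∀ s ∈ standardGen A ω ρ, s ∈ M := fun s hs => Submonoid.subset_closure hs
  have hinr : ∀ (g : Equiv.Perm (ℕ → Bool)) (hg : g ∈ grigorchukGroup ω),
      (SemidirectProduct.inr ⟨g, hg⟩ : WGroup A ω ρ) ∈ M ∧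
      (SemidirectProduct.inr (⟨g, hg⟩ : grigorchukGroup ω)⁻¹ : WGroup A ω ρ) ∈ M := by
    intro g hg
    refine Subgroup.closure_induction (p := fun g hg =>
      (SemidirectProduct.inr (⟨g, hg⟩ : grigorchukGroup ω) : WGroup A ω ρ) ∈ M ∧
      (SemidirectProduct.inr (⟨g, hg⟩ : grigorchukGroup ω)⁻¹ : WGroup A ω ρ) ∈ M)
      ?_ ?_ ?_ ?_ hg
    · rintro g (hg | ⟨x, rfl⟩)
      · rw [Set.mem_singleton_iff] at hg
        subst hg
        have hinv : (rootElt ω)⁻¹ = rootElt ω := rfl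
        exact ⟨hsub _ root_mem, by
          rw [show (⟨genA, _⟩ : grigorchukGroup ω)⁻¹ = rootElt ω from hinv]
          exact hsub _ root_mem⟩
      · have hinv : (spinalElt ω x)⁻¹ = spinalElt ω x := rfl
        exact ⟨hsub _ (spinal_mem x), by
          rw [show (⟨genBCD ω x, _⟩ : grigorchukGroup ω)⁻¹ = spinalElt ω x from hinv]
          exact hsub _ (spinal_mem x)⟩
    · have h1 : (⟨1, (grigorchukGroup ω).one_mem⟩ : grigorchukGroup ω) = 1 := rfl
      constructor
      · rw [h1, map_one]; exact M.one_mem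
      · rw [h1, inv_one, map_one]; exact M.one_mem
    · intro g h hg hh ihg ihh
      have h1 : (⟨g * h, (grigorchukGroup ω).mul_mem hg hh⟩ : grigorchukGroup ω) =
        ⟨g, hg⟩ * ⟨h, hh⟩ := rfl
      constructor
      · rw [h1, map_mul]; exact M.mul_mem ihg.1 ihh.1
      · rw [h1, mul_inv_rev, map_mul]; exact M.mul_mem ihh.2 ihg.2
    · intro g hg ih
      have h1 : (⟨g⁻¹, (grigorchukGroup ω).inv_mem hg⟩ : grigorchukGroup ω) = ⟨g, hg⟩⁻¹ := rfl
      constructor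
      · rw [h1]; exact ih.2
      · rw [h1, inv_inv]; exact ih.1
  have hlamp : ∀ (x : orbitX ω ρ) (y : A), lamp (grigorchukGroup ω) x y ∈ M := by
    intro x y
    obtain ⟨g, hg⟩ := x.2
    have hx : x = g • basePt ω ρ := Subtype.ext hg.symm
    rw [hx, ← inr_mul_lamp_mul_inr_inv]
    exact M.mul_mem (M.mul_mem (hinr g.1 g.2).1 (hsub _ (lamp_mem y))) (hinr g.1 g.2).2
  rw [eq_top_iff]
  rintro w -
  rw [← SemidirectProduct.inl_left_mul_inr_right w]
  exact M.mul_mem (inl_mem_of_lamp_mem M hlamp _) (hinr w.right.1 w.right.2).1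

theorem group_fg [Finite A] : Group.FG (WGroup A ω ρ) := by
  refine Group.fg_iff.mpr ⟨standardGen A ω ρ, ?_, standardGen_finite⟩
  rw [eq_top_iff]
  intro w _
  have h : w ∈ Submonoid.closure (standardGen A ω ρ) := by rw [closure_standardGen]; trivial
  exact Submonoid.closure_le.mpr (Subgroup.subset_closure (k := standardGen A ω ρ)) h

end Generators

/-! ### The upper bound -/

section Upper

variable {A : Type*} [Group A] {ω : ℕ → Fin 3} {ρ : ℕ → Bool}

/-- The extension of a function on the orbit by `1`. -/
noncomputable def extFun (f : orbitX ω ρ → A) : (ℕ → Bool) → A :=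
  Function.extend Subtype.val f 1

/-- The transformation of `(ℕ → Bool) × A` representing an element of the wreath product. -/
noncomputable def toTr (w : WGroup A ω ρ) : (ℕ → Bool) × A → (ℕ → Bool) × A :=
  wr (extFun w.left.1) (w.right : Equiv.Perm _)

theorem extFun_coe (f : orbitX ω ρ → A) (x : orbitX ω ρ) :
    extFun f x.1 = f x :=
  Subtype.val_injective.extend_apply f 1 x

theorem extFun_of_notMem (f : orbitX ω ρ → A) {ξ : ℕ → Bool} (h : ξ ∉ orbitX ω ρ) :
    extFun f ξ = 1 :=
  Function.extend_apply' f (1 : (ℕ → Bool) → A) ξ fun ⟨x, hx⟩ => h (hx ▸ x.2)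

theorem extFun_one : extFun (1 : orbitX ω ρ → A) = 1 := by
  funext ξ
  by_cases h : ξ ∈ orbitX ω ρ
  · exact extFun_coe 1 ⟨ξ, h⟩
  · exact extFun_of_notMem 1 h

theorem apply_mem_orbitX_iff (g : grigorchukGroup ω) (ξ : ℕ → Bool) :
    (g : Equiv.Perm (ℕ → Bool)) ξ ∈ orbitX ω ρ ↔ ξ ∈ orbitX ω ρ := by
  constructor
  · rintro ⟨h, hh⟩
    refine ⟨g⁻¹ * h, ?_⟩
    change (g⁻¹ * h) • ρ = ξ
    rw [mul_smul, inv_smul_eq_iff]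
    exact hh
  · rintro ⟨h, hh⟩
    refine ⟨g * h, ?_⟩
    change (g * h) • ρ = _
    rw [mul_smul]
    exact congrArg _ hh

/-- The orbit is invariant and there are no lamps outside it, so extending to all sequences respects
products. -/
theorem toTr_mul (v w : WGroup A ω ρ) : toTr (v * w) = toTr v ∘ toTr w := by
  funext ⟨ξ, y⟩
  refine Prod.ext rfl ?_
  change extFun (v * w).left.1
      ((v.right : Equiv.Perm (ℕ → Bool)) ((w.right : Equiv.Perm (ℕ → Bool)) ξ)) * y =
    extFun v.left.1
      ((v.right : Equiv.Perm (ℕ → Bool)) ((w.right : Equiv.Perm (ℕ → Bool)) ξ)) *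
    (extFun w.left.1 ((w.right : Equiv.Perm (ℕ → Bool)) ξ) * y)
  by_cases h : ξ ∈ orbitX ω ρ
  · set x : orbitX ω ρ := w.right • ⟨ξ, h⟩ with hx
    change extFun (v * w).left.1 (v.right • x).1 * y =
      extFun v.left.1 (v.right • x).1 *
        (extFun w.left.1 x.1 * y)
    rw [extFun_coe, extFun_coe, extFun_coe, ← mul_assoc]
    congr 1
    change v.left.1 _ * (permAction A _ _ v.right w.left).1 _ = _
    rw [permAction_apply, inv_smul_smul]
  · have h1 := mt (apply_mem_orbitX_iff (ρ := ρ) w.right ξ).1 h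
    have h2 := mt (apply_mem_orbitX_iff (ρ := ρ) v.right _).1 h1
    rw [extFun_of_notMem _ h1, extFun_of_notMem _ h2, extFun_of_notMem _ h2, one_mul, one_mul]

theorem toTr_injective : Function.Injective (toTr : WGroup A ω ρ → _) := by
  intro v w h
  have hr : v.right = w.right := by
    apply Subtype.ext
    apply Equiv.ext
    intro ξ
    exact congrArg Prod.fst (congrFun h (ξ, 1))
  refine SemidirectProduct.ext ?_ hr
  apply Subtype.ext
  funext x
  have h1 := congrArg Prod.snd (congrFun h ((v.right : Equiv.Perm (ℕ → Bool)).symm x.1, 1))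
  simp only [toTr, wr, mul_one] at h1
  rw [← hr, Equiv.apply_symm_apply, extFun_coe, extFun_coe] at h1
  exact h1

theorem toTr_one : toTr (1 : WGroup A ω ρ) = id := by
  funext z
  change (z.1, extFun (1 : orbitX ω ρ → A) z.1 * z.2) = z
  rw [extFun_one, Pi.one_apply, one_mul]

variable {α : ℝ} {ν : Fin 3 → ℝ}

theorem exists_represents (hα : 0 ≤ α) (hν : ∀ x, 0 ≤ ν x)
    (htri : ∀ x y z, x ≠ y → y ≠ z → x ≠ z → ν x ≤ ν y + ν z) (w : WGroup A ω ρ) :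
    ∃ t, 0 ≤ t ∧ Represents ω ρ α ν t (toTr w) := by
  have hw : w ∈ Submonoid.closure (standardGen A ω ρ) := by rw [closure_standardGen]; trivial
  refine Submonoid.closure_induction
    (motive := fun w _ => ∃ t, 0 ≤ t ∧ Represents ω ρ α ν t (toTr w)) ?_ ?_ ?_ hw
  · rintro _ (rfl | ⟨x, rfl⟩ | ⟨y, rfl⟩)
    · refine ⟨α, hα, ?_⟩
      have h : toTr (SemidirectProduct.inr (rootElt ω) : WGroup A ω ρ) = id ∘ rootTr A := by
        funext z
        refine Prod.ext rfl ?_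
        change extFun (1 : orbitX ω ρ → A) _ * z.2 = _
        rw [extFun_one]
        rfl
      rw [h]
      have h0 : Represents ω ρ α ν 0 (id : (ℕ → Bool) × A → (ℕ → Bool) × A) :=
        .slot (isSlot_id ω ρ) le_rfl
      simpa only [zero_add] using h0.comp_rootTr
    · refine ⟨ν x, hν x, .slot (v := some x) ⟨1, fun _ _ => rfl, ?_⟩ le_rfl⟩
      funext z
      refine Prod.ext rfl ?_
      change extFun (1 : orbitX ω ρ → A) _ * z.2 = _
      rw [extFun_one]
      rfl
    · refine ⟨0, le_rfl, .slot (v := none) ⟨extFun (indicatorFun y {basePt ω ρ}).1,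
        fun ξ hξ => ?_, rfl⟩ le_rfl⟩
      by_cases h : ξ ∈ orbitX ω ρ
      · rw [extFun_coe _ ⟨ξ, h⟩, indicatorFun_apply, if_neg]
        intro hmem
        rw [Finset.mem_singleton] at hmem
        exact hξ ⟨(none, false), (congrArg Subtype.val hmem).symm⟩
      · exact extFun_of_notMem _ h
  · exact ⟨0, le_rfl, by rw [toTr_one]; exact .slot (isSlot_id ω ρ) le_rfl⟩
  · rintro v w - - ⟨t, ht, hv⟩ ⟨t', ht', hw⟩
    exact ⟨t + t', add_nonneg ht ht', by rw [toTr_mul]; exact hv.comp hν htri hw⟩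

theorem represents_list_prod (hν : ∀ x, 0 ≤ ν x)
    (htri : ∀ x y z, x ≠ y → y ≠ z → x ≠ z → ν x ≤ ν y + ν z) {K : ℝ} (l : List (WGroup A ω ρ))
    (hl : ∀ s ∈ l, Represents ω ρ α ν K (toTr s)) :
    Represents ω ρ α ν (l.length * K) (toTr l.prod) := by
  induction l with
  | nil =>
    rw [List.prod_nil, toTr_one]
    exact .slot (isSlot_id ω ρ) (by simp [fourNorm])
  | cons s l ih =>
    rw [List.prod_cons, toTr_mul]
    refine ((hl s (by simp)).comp hν htri (ih fun r hr => hl r (by simp [hr]))).mono ?_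
    push_cast [List.length_cons]
    linarith

theorem growth_le [Finite A] {η : ℝ} (hη₂ : 2 < η) (N : ContractingNorm ω η)
    {S : Set (WGroup A ω ρ)} (hS : S.Finite) :
    ∃ C K : ℝ, 0 < C ∧ 0 ≤ K ∧ ∀ (n : ℕ) (R : ℝ), 0 ≤ R →
      growth S R ≤ Real.exp (C * ((2 / η) ^ n * (R * K) + 2 ^ n)) := by
  obtain ⟨C, hC, hcount⟩ := card_le_of_represents (A := A) hη₂ N ρ
  have hα : 0 ≤ N.α 0 := N.lower_pos.le.trans (N.lower_le 0)
  choose t ht htr using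
    exists_represents (A := A) (ρ := ρ) hα (N.nonneg 0) (N.triangle 0)
  -- The sum serves as a common bound for the norms of the generators.
  set K := ∑ s ∈ hS.toFinset, t s with hK
  have hK0 : 0 ≤ K := Finset.sum_nonneg fun s _ => ht s
  have hSK : ∀ s ∈ S, Represents ω ρ (N.α 0) (N.ν 0) K (toTr s) := fun s hs =>
    (htr s).mono (Finset.single_le_sum (fun s _ => ht s) (hS.mem_toFinset.mpr hs))
  refine ⟨C, K, hC, hK0, fun n R hR => ?_⟩
  unfold growth
  set B := {g : WGroup A ω ρ | ∃ l : List (WGroup A ω ρ), (∀ s ∈ l, s ∈ S) ∧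
    (l.length : ℝ) ≤ R ∧ l.prod = g} with hB
  by_cases hfin : B.Finite
  · rw [Set.ncard_eq_toFinset_card B hfin]
    refine hcount hfin.toFinset toTr n (R * K) toTr_injective (by positivity) fun g hg => ?_
    obtain ⟨l, hl, hlR, rfl⟩ := hfin.mem_toFinset.mp hg
    exact (represents_list_prod (N.nonneg 0) (N.triangle 0) l fun s hs => hSK s (hl s hs)).mono
      (mul_le_mul_of_nonneg_right hlR hK0)
  -- An infinite set has `ncard` zero, so finiteness of the ball need not be checked.
  · rw [Set.Infinite.ncard hfin]
    simpa using (Real.exp_pos _).le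

end Upper

/-! ### The lower bound -/

section Lower

variable {A : Type*} [Group A] {ω : ℕ → Fin 3} {ρ : ℕ → Bool}

variable (ω) in
/-- The element of the Grigorchuk group given by a word. -/
def wordElt (w : List (Fin 3)) : grigorchukGroup ω :=
  (w.map fun x => rootElt ω * spinalElt ω x).prod

open Classical in
variable (ω ρ) in
/-- The points at which a word can place lamps. -/
noncomputable def lampPos : List (Fin 3) → Finset (orbitX ω ρ)
  | [] => ∅
  | x :: w => {basePt ω ρ, rootElt ω • basePt ω ρ} ∪
      (lampPos w).image fun p => (rootElt ω * spinalElt ω x) • p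

theorem rootElt_smul_basePt_ne : rootElt ω • basePt ω ρ ≠ basePt ω ρ := by
  intro h
  have h1 : rootFun ρ = ρ := congrArg Subtype.val h
  have h2 := congrFun h1 0
  simp [rootFun, cons] at h2

theorem trace_subset_lampPos (w : List (Fin 3)) :
    trace ω w ρ ⊆ Subtype.val '' (lampPos ω ρ w : Set (orbitX ω ρ)) := by
  classical
  rintro q ⟨u, v, -, hv, rfl, hq⟩
  induction u generalizing q with
  | nil =>
    obtain ⟨x, v, rfl⟩ := List.exists_cons_of_ne_nil hv
    rcases hq with hq | hq
    · exact ⟨basePt ω ρ, by simp [lampPos], hq.symm⟩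
    · exact ⟨rootElt ω • basePt ω ρ, by simp [lampPos], hq.symm⟩
  | cons x u ih =>
    have key : ∀ q', (q' = evalWord ω u ρ ∨ q' = evalWord ω u (rootFun ρ)) →
        rootFun (spinalFun x ω q') ∈
          Subtype.val '' (lampPos ω ρ (x :: u ++ v) : Set (orbitX ω ρ)) := by
      intro q' hq'
      obtain ⟨p, hp, rfl⟩ := ih hq'
      refine ⟨(rootElt ω * spinalElt ω x) • p, ?_, rfl⟩
      simp only [List.cons_append, lampPos, Finset.coe_union, Finset.coe_image]
      exact Or.inr ⟨p, hp, rfl⟩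
    rcases hq with rfl | rfl
    · exact key _ (Or.inl rfl)
    · exact key _ (Or.inr rfl)

theorem ncard_trace_le (w : List (Fin 3)) :
    (trace ω w ρ).ncard ≤ (lampPos ω ρ w).card := by
  refine (Set.ncard_le_ncard (trace_subset_lampPos w) ((Finset.finite_toSet _).image _)).trans ?_
  rw [Set.ncard_image_of_injective _ Subtype.val_injective, Set.ncard_coe_finset]

/-- All lamp configurations on the points of `lampPos` are reached by short products. -/
theorem exists_list_standardGen (y : A) (w : List (Fin 3)) (U : Finset (orbitX ω ρ))
    (hU : U ⊆ lampPos ω ρ w) :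
    ∃ l : List (WGroup A ω ρ), (∀ s ∈ l, s ∈ standardGen A ω ρ) ∧ l.length = 4 * w.length ∧
      l.prod = ⟨indicatorFun y U, wordElt ω w⟩ := by
  classical
  induction w generalizing U with
  | nil =>
    refine ⟨[], by simp, rfl, ?_⟩
    have hU' : U = ∅ := Finset.subset_empty.mp hU
    subst hU'
    refine SemidirectProduct.ext ?_ rfl
    ext p
    simp [indicatorFun_apply]
  | cons x w ih =>
    set g := rootElt ω * spinalElt ω x with hg
    set p₀ := basePt ω ρ with hp₀
    set p₁ := rootElt ω • p₀ with hp₁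
    have hne : p₁ ≠ p₀ := rootElt_smul_basePt_ne
    -- The first letter provides the lamps at `ρ` and `a ρ`; the others are moved back by `g = ax`
    -- and left to the rest of the word.
    set U' := (U \ {p₀, p₁}).image fun p => g⁻¹ • p with hU'
    have hU'mem : ∀ p, g⁻¹ • p ∈ U' ↔ p ∈ U \ {p₀, p₁} := fun p => by
      simp only [hU', Finset.mem_image]
      constructor
      · rintro ⟨r, hr, hrp⟩
        rwa [← smul_left_cancel g⁻¹ hrp]
      · exact fun h => ⟨p, h, rfl⟩
    have hsub : U' ⊆ lampPos ω ρ w := by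
      intro p hp
      obtain ⟨r, hr, rfl⟩ := Finset.mem_image.mp hp
      rw [Finset.mem_sdiff] at hr
      have h := hU hr.1
      simp only [lampPos, Finset.mem_union, Finset.mem_image] at h
      rcases h with h | ⟨s, hs, rfl⟩
      · exact absurd h hr.2
      · change g⁻¹ • g • s ∈ _
        rwa [inv_smul_smul]
    obtain ⟨l, hl, hlen, hprod⟩ := ih U' hsub
    set y₀ : A := if p₀ ∈ U then y else 1 with hy₀
    set y₁ : A := if p₁ ∈ U then y else 1 with hy₁
    -- Moving the second lamp to the left across `a` places it at `a ρ`. Trivial lamps are kept, so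
    -- each letter costs exactly four generators.
    refine ⟨lamp _ p₀ y₀ :: SemidirectProduct.inr (rootElt ω) :: lamp _ p₀ y₁ ::
      SemidirectProduct.inr (spinalElt ω x) :: l, ?_, ?_, ?_⟩
    · intro s hs
      simp only [List.mem_cons] at hs
      rcases hs with rfl | rfl | rfl | rfl | hs
      · exact lamp_mem _
      · exact root_mem
      · exact lamp_mem _
      · exact spinal_mem x
      · exact hl s hs
    · simp only [List.length_cons, hlen]; ring
    · have hconj : (SemidirectProduct.inr (rootElt ω) : WGroup A ω ρ) * lamp _ p₀ y₁ =
          lamp _ p₁ y₁ * SemidirectProduct.inr (rootElt ω) := by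
        rw [hp₁, ← inr_mul_lamp_mul_inr_inv, mul_assoc, ← map_mul, inv_mul_cancel, map_one,
          mul_one]
      have hmk : (⟨indicatorFun y U', wordElt ω w⟩ : WGroup A ω ρ) =
          SemidirectProduct.inl (indicatorFun y U') * SemidirectProduct.inr (wordElt ω w) :=
        SemidirectProduct.mk_eq_inl_mul_inr _ _
      simp only [List.prod_cons, hprod]
      rw [← mul_assoc (SemidirectProduct.inr (rootElt ω)), hconj, mul_assoc,
        ← mul_assoc (SemidirectProduct.inr (rootElt ω)), ← map_mul, ← hg]
      refine SemidirectProduct.ext ?_ ?_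
      · apply Subtype.ext
        funext p
        simp only [SemidirectProduct.mul_left, lamp, SemidirectProduct.left_inl,
          SemidirectProduct.right_inl, SemidirectProduct.left_inr, SemidirectProduct.right_inr,
          map_one, MulAut.one_apply, one_mul]
        change (indicatorFun y₀ {p₀}).1 p * ((indicatorFun y₁ {p₁}).1 p *
          (permAction A _ _ g (indicatorFun y U')).1 p) = _
        rw [permAction_apply]
        simp only [indicatorFun_apply, hU'mem, Finset.mem_sdiff, Finset.mem_insert,
          Finset.mem_singleton]
        by_cases h0 : p = p₀
        · subst h0
          simp [hy₀, hne.symm]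
        · by_cases h1 : p = p₁
          · subst h1
            simp [hy₁, hne]
          · simp [h0, h1]
      · simp [lamp, wordElt, hg]

/-! ### Balls and change of generating set -/

theorem ball_finite {W : Type*} [Group W] {S : Set W} (hS : S.Finite) (R : ℝ) :
    {g : W | ∃ l : List W, (∀ s ∈ l, s ∈ S) ∧ (l.length : ℝ) ≤ R ∧ l.prod = g}.Finite := by
  have := hS.to_subtype
  refine ((List.finite_length_le S ⌊R⌋₊).image fun l => (l.map Subtype.val).prod).subset ?_
  rintro g ⟨l, hl, hR, rfl⟩
  refine ⟨l.attach.map fun s => ⟨s.1, hl _ s.2⟩, ?_, ?_⟩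
  · simpa using Nat.le_floor hR
  · simp

/-- Elements of a finite set are products of boundedly many elements of a generating set. -/
theorem exists_list_bound {W : Type*} [Group W] {S T : Set W} (hT : T.Finite)
    (hgen : Submonoid.closure S = ⊤) :
    ∃ L : ℕ, ∀ l : List W, (∀ s ∈ l, s ∈ T) →
      ∃ l' : List W, (∀ s ∈ l', s ∈ S) ∧ l'.length ≤ L * l.length ∧ l'.prod = l.prod := by
  have h : ∀ w : W, ∃ l : List W, (∀ s ∈ l, s ∈ S) ∧ l.prod = w := fun w =>
    Submonoid.exists_list_of_mem_closure (by rw [hgen]; trivial)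
  choose f hf hprod using h
  refine ⟨∑ s ∈ hT.toFinset, (f s).length, fun l hl => ⟨l.flatMap f, ?_, ?_, ?_⟩⟩
  · intro s hs
    obtain ⟨r, hr, hsr⟩ := List.mem_flatMap.mp hs
    exact hf r s hsr
  · induction l with
    | nil => simp
    | cons r l ih =>
      have h1 := ih fun s hs => hl s (by simp [hs])
      have h2 : (f r).length ≤ ∑ s ∈ hT.toFinset, (f s).length :=
        Finset.single_le_sum (f := fun s => (f s).length) (fun s _ => Nat.zero_le _)
          (hT.mem_toFinset.mpr (hl r (by simp)))
      rw [List.flatMap_cons, List.length_append, List.length_cons, mul_add, mul_one]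
      omega
  · clear hl
    induction l with
    | nil => simp
    | cons r l ih => rw [List.flatMap_cons, List.prod_append, ih, hprod, List.prod_cons]

/-- Over a fixed word, distinct sets of points lit by a fixed nontrivial lamp give distinct
elements. -/
theorem le_growth [Finite A] [Nontrivial A] {S : Set (WGroup A ω ρ)} (hS : S.Finite)
    (hgen : Submonoid.closure S = ⊤) :
    ∃ L : ℕ, ∀ (w : List (Fin 3)) (R : ℝ), (L : ℝ) * w.length ≤ R →
      (2 : ℝ) ^ (trace ω w ρ).ncard ≤ growth S R := by
  classical
  obtain ⟨L, hL⟩ := exists_list_bound (standardGen_finite (A := A) (ω := ω) (ρ := ρ)) hgen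
  obtain ⟨y, hy⟩ := exists_ne (1 : A)
  refine ⟨L * 4, fun w R hR => ?_⟩
  set F : Finset (orbitX ω ρ) → WGroup A ω ρ := fun U => ⟨indicatorFun y U, wordElt ω w⟩ with hF
  have hinj : Function.Injective F := by
    intro U V h
    have h1 : indicatorFun y U = indicatorFun y V := congrArg SemidirectProduct.left h
    ext p
    have h2 := congrFun (congrArg Subtype.val h1) p
    rw [indicatorFun_apply, indicatorFun_apply] at h2
    by_cases hp : p ∈ U <;> by_cases hq : p ∈ V <;> simp_all
  have hsub : (((lampPos ω ρ w).powerset.image F : Finset _) : Set (WGroup A ω ρ)) ⊆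
      {g | ∃ l : List (WGroup A ω ρ), (∀ s ∈ l, s ∈ S) ∧ (l.length : ℝ) ≤ R ∧ l.prod = g} := by
    intro g hg
    obtain ⟨U, hU, rfl⟩ := Finset.mem_image.mp (Finset.mem_coe.mp hg)
    obtain ⟨l, hl, hlen, hprod⟩ := exists_list_standardGen y w U (Finset.mem_powerset.mp hU)
    obtain ⟨l', hl', hlen', hprod'⟩ := hL l hl
    refine ⟨l', hl', le_trans ?_ hR, hprod'.trans hprod⟩
    rw [hlen] at hlen'
    have h3 : (l'.length : ℝ) ≤ ((L * (4 * w.length) : ℕ) : ℝ) := by exact_mod_cast hlen'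
    push_cast at h3 ⊢
    linarith
  have hcard := Set.ncard_le_ncard hsub (ball_finite hS R)
  rw [Set.ncard_coe_finset, Finset.card_image_of_injective _ hinj, Finset.card_powerset] at hcard
  have h4 : 2 ^ (trace ω w ρ).ncard ≤ 2 ^ (lampPos ω ρ w).card :=
    Nat.pow_le_pow_right (by norm_num) (ncard_trace_le w)
  unfold growth
  exact_mod_cast h4.trans hcard

end Lower

/-! ### The growth of the wreath product -/

/-- Raising to the power `log 2 / log η` turns `η ^ n` into `2 ^ n`. -/
theorem exists_pow_near {η : ℝ} (hη₂ : 2 < η) {R : ℝ} (hR : 1 < R) :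
    ∃ n : ℕ, η ^ n ≤ R ∧ R ≤ η ^ (n + 1) ∧
      (2 : ℝ) ^ n ≤ R ^ (Real.log 2 / Real.log η) ∧
      R ^ (Real.log 2 / Real.log η) ≤ 2 ^ (n + 1) := by
  obtain ⟨n, h1, h2⟩ := exists_nat_pow_near hR.le (by linarith : (1 : ℝ) < η)
  have hη0 : 0 < η := by linarith
  have hlog : 0 < Real.log η := Real.log_pos (by linarith)
  have hlog2 : 0 < Real.log 2 := Real.log_pos (by norm_num)
  have hα : 0 < Real.log 2 / Real.log η := div_pos hlog2 hlog
  have hpow : ∀ m : ℕ, (η ^ m) ^ (Real.log 2 / Real.log η) = 2 ^ m := fun m => by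
    rw [← Real.rpow_natCast, ← Real.rpow_mul hη0.le, mul_comm, Real.rpow_mul hη0.le,
      Real.rpow_natCast]
    congr 1
    rw [Real.rpow_def_of_pos hη0, mul_div_cancel₀ _ hlog.ne', Real.exp_log (by norm_num)]
  refine ⟨n, h1, h2.le, ?_, ?_⟩
  · rw [← hpow]; exact Real.rpow_le_rpow (by positivity) h1 hα.le
  · rw [← hpow]; exact Real.rpow_le_rpow (by linarith) h2.le hα.le

section Main

variable {A : Type*} [Group A] [Finite A] {ω : ℕ → Fin 3} {ρ : ℕ → Bool} {η : ℝ}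

theorem growthLE_exp (hη₂ : 2 < η) (N : ContractingNorm ω η) {S : Set (WGroup A ω ρ)}
    (hS : S.Finite) :
    GrowthLE (growth S) fun R : ℝ => Real.exp (R ^ (Real.log 2 / Real.log η)) := by
  obtain ⟨C, K, hC, hK, h⟩ := growth_le (A := A) (ρ := ρ) hη₂ N hS
  set α := Real.log 2 / Real.log η with hα
  have hα0 : 0 < α := div_pos (Real.log_pos (by norm_num)) (Real.log_pos (by linarith))
  set D := 2 * C * (K + 1) with hD
  have hD0 : 0 < D := by positivity
  -- Dilating `R` by `D ^ (1 / α)` multiplies `R ^ α` by `D`.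
  refine ⟨D ^ (1 / α), by positivity, 1, one_pos, fun R hR => ?_⟩
  obtain ⟨n, -, hn2, hn3, -⟩ := exists_pow_near hη₂ hR
  refine (h (n + 1) R (by linarith)).trans (Real.exp_le_exp.mpr ?_)
  rw [Real.mul_rpow (by positivity) (by linarith), ← Real.rpow_mul hD0.le,
    one_div_mul_cancel hα0.ne', Real.rpow_one]
  have h1 : (2 / η) ^ (n + 1) * R ≤ 2 ^ (n + 1) := by
    rw [div_pow, div_mul_eq_mul_div, div_le_iff₀ (by positivity)]
    exact mul_le_mul_of_nonneg_left hn2 (by positivity)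
  calc C * ((2 / η) ^ (n + 1) * (R * K) + 2 ^ (n + 1))
      = C * ((2 / η) ^ (n + 1) * R * K + 2 ^ (n + 1)) := by ring
    _ ≤ C * (2 ^ (n + 1) * K + 2 ^ (n + 1)) := by gcongr
    _ = D * 2 ^ n := by rw [hD]; ring
    _ ≤ D * R ^ α := mul_le_mul_of_nonneg_left hn3 hD0.le

theorem exp_growthLE [Nontrivial A] (hη₂ : 2 < η) {V : ℕ → Fin 3 → ℝ} {c C : ℝ} (hc : 0 < c)
    (hstep : ∀ n, η • V (n + 1) = stepVec (ω n) (V n)) (hcV : ∀ x, c ≤ V 0 x)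
    (hVC : ∀ n, V n 0 ≤ C) {S : Set (WGroup A ω ρ)} (hS : S.Finite)
    (hgen : Submonoid.closure S = ⊤) :
    GrowthLE (fun R : ℝ => Real.exp (R ^ (Real.log 2 / Real.log η))) (growth S) := by
  obtain ⟨L, hL⟩ := le_growth (A := A) hS hgen
  have hC : 0 < C := hc.trans_le ((hcV 0).trans (hVC 0))
  have hη0 : 0 < η := by linarith
  refine ⟨(L + 1) * (2 * C / c) * η ^ 2, by positivity, 1, one_pos, fun R hR => ?_⟩
  obtain ⟨n, hn1, -, -, hn4⟩ := exists_pow_near hη₂ hR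
  -- One extra level covers `R ^ (log 2 / log η) ≤ 2 ^ (n + 1)`, the other the passage from base `e`
  -- to base 2, by `log 2 ≥ 1 / 2`. Together they cost the factor `η ^ 2`.
  obtain ⟨w, hw, hsum⟩ := exists_word ω hstep ρ (n + 2) 0
  simp only [Function.iterate_zero, id, zero_add] at hw hsum
  have hlen : w.length * c ≤ (w.map (V 0)).sum := by
    have h := List.card_nsmul_le_sum (w.map (V 0)) c fun x hx => by
      obtain ⟨i, -, rfl⟩ := List.mem_map.mp hx
      exact hcV i
    simpa using h
  have hlen' : (w.length : ℝ) ≤ 2 * C / c * η ^ 2 * R := by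
    rw [show 2 * C / c * η ^ 2 * R = (η ^ 2 * R * (2 * C)) / c by ring, le_div_iff₀ hc]
    refine hlen.trans ?_
    rw [hsum, pow_add]
    calc η ^ n * η ^ 2 * (2 * V (n + 2) 0) ≤ η ^ n * η ^ 2 * (2 * C) := by
          have := hVC (n + 2)
          gcongr
      _ ≤ R * η ^ 2 * (2 * C) := by gcongr
      _ = η ^ 2 * R * (2 * C) := by ring
  refine le_trans ?_ (hL w _ ?_)
  · have hlog : 1 / 2 ≤ Real.log 2 := by
      have := Real.log_two_gt_d9; linarith
    calc Real.exp (R ^ (Real.log 2 / Real.log η)) ≤ Real.exp (2 ^ (n + 1)) :=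
          Real.exp_le_exp.mpr hn4
      _ ≤ Real.exp (Real.log 2 * 2 ^ (n + 2)) := by
          apply Real.exp_le_exp.mpr
          have h2 : (0 : ℝ) < 2 ^ (n + 1) := by positivity
          rw [pow_succ 2 (n + 1)]
          nlinarith
      _ = 2 ^ (2 ^ (n + 2)) := by
          rw [← Real.rpow_natCast 2 (2 ^ (n + 2)), Real.rpow_def_of_pos (by norm_num)]
          push_cast
          rfl
      _ ≤ 2 ^ (trace ω w ρ).ncard := pow_le_pow_right₀ (by norm_num) hw
  · calc (L : ℝ) * w.length ≤ (L + 1) * (2 * C / c * η ^ 2 * R) := by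
          gcongr
          linarith
      _ = _ := by ring

end Main

end GrigorchukWreath

open GrigorchukWreath in
theorem proposition4p3 {A : Type*} [Group A] [Finite A] [Nontrivial A]
    (ω : ℕ → Fin 3) (k : ℕ) (hk : 0 < k) (hω : ∀ n, ω (n + k) = ω n)
    (ρ : ℕ → Bool) (η : ℝ) (hη₂ : 2 < η) (hη₃ : η < 3)
    (hη : spectralRadius ℂ (matProd ω k) = ENNReal.ofReal (η ^ k)) :
    Group.FG (WGroup A ω ρ) ∧
      ∀ S : Set (WGroup A ω ρ), S.Finite → Submonoid.closure S = ⊤ →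
        GrowthEquiv (growth S) (fun R : ℝ => Real.exp (R ^ (Real.log 2 / Real.log η))) := by
  obtain ⟨V, hV, hper, hstep⟩ := exists_weights ω k hk hω η hη₂ hη
  obtain ⟨N⟩ := exists_contractingNorm hk (exists_eq_of_two_lt ω k hη₂ hk hη) hω hη₂ hV hper hstep
  obtain ⟨_, C, -, hC⟩ := exists_bounds_of_periodic (f := fun n => V n 0) hk
    (fun n => by rw [hper]) fun n => hV n 0
  obtain ⟨i, -, hi⟩ := Finset.exists_min_image Finset.univ (V 0) Finset.univ_nonempty
  exact ⟨group_fg, fun S hS hgen => ⟨growthLE_exp hη₂ N hS,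
    exp_growthLE hη₂ (hV 0 i) hstep (fun x => hi x (Finset.mem_univ x)) (fun n => (hC n).2)
      hS hgen⟩⟩
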